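/- Let $N\ge 1$ and $0<s<1$. For $v:\mathbb{R}^N\to\mathbb{R}$ put $\|v\|_s^2=\iint_{\mathbb{R}^{2N}}\frac{|v(x)-v(y)|^2}{|x-y|^{N+2s}}\,dx\,dy$; $H^s(\mathbb{R}^N)$ is the space of $v\in L^2(\mathbb{R}^N)$ with $\|v\|_s<\infty$, normed by $(\|v\|_{L^2}^2+\|v\|_s^2)^{1/2}$, and $H^{-s}(\mathbb{R}^N)$ is its dual, where $f\in L^2(\mathbb{R}^N)$ is identified with the functional $\varphi\mapsto\int f\varphi$. For an open set $\Omega\subseteq\mathbb{R}^N$ let $\mathcal X^s_0(\Omega)=\{v\in H^s(\mathbb{R}^N): v=0 \text{ a.e. in }\mathbb{R}^N\setminus\Omega\}$. Given $f\in L^2(\mathbb{R}^N)$, a weak solution of the restricted fractional Poisson problem $(-\Delta)^su=f$ in $\Omega$, $u=0$ in $\mathbb{R}^N\setminus\Omega$, is a function $u\in\mathcal X^s_0(\Omega)$ such that $$C(N,s)\iint_{\mathbb{R}^{2N}}\frac{(u(x)-u(y))(\varphi(x)-\varphi(y))}{|x-y|^{N+2s}}\,dx\,dy=\int_{\mathbb{R}^N}f\varphi\,dx\qquad\text{for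 all }\varphi\in\mathcal X^s_0(\Omega),$$ where $C(N,s)=\Big(\int_{\mathbb{R}^N}\frac{1-\cos x_1}{|x|^{N+2s}}\,dx\Big)^{-1}$. For $\rho>0$, $\theta\in(0,\pi/2)$ and a unit vector $n$ let $\mathcal C_{\rho,\theta}(n)=\{v: 0<|v|<\rho,\ v\cdot n>|v|\cos\theta\}$. The set $\Omega$ satisfies the $(\rho,\theta)$-Lipschitz cone condition if for every $x_0\in\mathbb{R}^N$ there is a unit vector $n$ such that, for all $v\in\mathcal C_{\rho,\theta}(n)$: $y-v\in\Omega$ for every $y\in B_{3\rho}(x_0)\cap\Omega$, and $y+v\notin\Omega$ for every $y\in B_{3\rho}(x_0)\setminus\Omega$. For $r\in(0,1]$ let $\|u\|_{B^r_{2,\infty}}=\|u\|_{L^2}+\sup_{h\ne0}|h|^{-r}\|u(\cdot+2h)-2u(\cdot+h)+u\|_{L^2}$, and for $r>1$ let $\|u\|_{B^r_{2,\infty}}=\|u\|_{L^2}+\sum_{i=1}^N\|\partial_iu\|_{B^{r-1}_{2,\infty}}$ with distributional derivatives; $B^r_{2,\infty}(\mathbb{R}^N)$ is the space of $u\in L^2(\mathbb{R}^N)$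 for which this is (defined and) finite. **Theorem.** Let $N\ge1$, $s\in(0,1)$, $\rho\in(0,\infty)$, $\theta\in(0,\pi/2)$. Let $\Omega\subset\mathbb{R}^N$ be a bounded open set that satisfies the $(\rho,\theta)$-Lipschitz cone condition, let $f\in L^2(\mathbb{R}^N)$, and let $u\in\mathcal X^s_0(\Omega)$ be the weak solution of $(-\Delta)^su=f$ in $\Omega$, $u=0$ in $\mathbb{R}^N\setminus\Omega$. Then $u\in B^{3s/2}_{2,\infty}(\mathbb{R}^N)$ and $$\|u\|_{B^{3s/2}_{2,\infty}(\mathbb{R}^N)}\le C\,\|f\|_{H^{-s}(\mathbb{R}^N)}^{1/2}\,\|f\|_{L^2(\mathbb{R}^N)}^{1/2},$$ where the constant $C$ depends only on $N$, $s$, $\mathrm{diam}\,\Omega$, $\rho$ and $\theta$. -/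

import Mathlib

open MeasureTheory
open scoped ContDiff

noncomputable section

namespace FracPoisson

/-- Euclidean space `ℝ^N`. -/
abbrev Eucl (N : ℕ) : Type := EuclideanSpace ℝ (Fin N)

variable {N : ℕ}

/-! ### The fractional Sobolev space `H^s` and its dual norm -/

/-- The singular kernel `K_s(z) = |z|^{-N-2s}`. -/
def kernel (s : ℝ) (z : Eucl N) : ℝ := ‖z‖ ^ (-(N : ℝ) - 2 * s)

/-- The square of the Gagliardo seminorm,
`∬ K_s(x - y) |v(x) - v(y)|² dx dy`, with values in `[0, ∞]`. -/
def gagliardoSq (s : ℝ) (v : Eucl N → ℝ) : ENNReal :=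
  ∫⁻ p : Eucl N × Eucl N, ENNReal.ofReal (kernel s (p.1 - p.2) * |v p.1 - v p.2| ^ 2)

/-- The norm of `H^s(ℝ^N) = W^{s,2}(ℝ^N)`, `0 < s < 1`:
the square root of `‖v‖²_{L²}` plus the squared Gagliardo seminorm. -/
def sobolevNorm (s : ℝ) (v : Eucl N → ℝ) : ENNReal :=
  (eLpNorm v 2 volume ^ 2 + gagliardoSq s v) ^ (1 / 2 : ℝ)

/-- `v ∈ H^s(ℝ^N)`, `0 < s < 1`. -/
def MemSobolev (s : ℝ) (v : Eucl N → ℝ) : Prop :=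
  MemLp v 2 volume ∧ gagliardoSq s v < ⊤

/-- The norm in `H^{-s}(ℝ^N)`, the dual space of `H^s(ℝ^N)`, of (the functional
`φ ↦ ∫ f φ` induced by) a function `f ∈ L²(ℝ^N)`. -/
def dualSobolevNorm (s : ℝ) (f : Eucl N → ℝ) : ENNReal :=
  ⨆ (φ : Eucl N → ℝ) (_ : MemSobolev s φ) (_ : sobolevNorm s φ ≤ 1), ‖∫ x, f x * φ x‖ₑ

/-! ### The restricted fractional Poisson problem -/

/-- `v ∈ 𝒳^s_0(Ω)`: `v ∈ H^s(ℝ^N)` and `v = 0` a.e. outside `Ω`. -/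
def MemX0 (s : ℝ) (Ω : Set (Eucl N)) (v : Eucl N → ℝ) : Prop :=
  MemSobolev s v ∧ ∀ᵐ x ∂(volume : Measure (Eucl N)), x ∉ Ω → v x = 0

/-- The normalization constant
`C(N, s) = (∫ (1 - cos x₁) / |x|^{N+2s} dx)⁻¹` of the fractional Laplacian. -/
def normConst (N : ℕ) [NeZero N] (s : ℝ) : ℝ :=
  (∫ x : Eucl N, (1 - Real.cos (x 0)) / ‖x‖ ^ ((N : ℝ) + 2 * s))⁻¹

/-- `u` is a weak solution of `(-Δ)^s u = f` in `Ω`, `u = 0` in `ℝ^N ∖ Ω`, where `f ∈ L²(ℝ^N)`. -/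
def IsWeakSolution [NeZero N] (s : ℝ) (Ω : Set (Eucl N)) (f u : Eucl N → ℝ) : Prop :=
  MemX0 s Ω u ∧ ∀ φ : Eucl N → ℝ, MemX0 s Ω φ →
    normConst N s * ∫ p : Eucl N × Eucl N,
      kernel s (p.1 - p.2) * ((u p.1 - u p.2) * (φ p.1 - φ p.2)) = ∫ x, f x * φ x

/-! ### The Lipschitz cone condition -/

/-- The open cone `{v : 0 < |v| < ρ, v · n > |v| cos θ}`. -/
def cone (ρ θ : ℝ) (n : Eucl N) : Set (Eucl N) :=
  {v | 0 < ‖v‖ ∧ ‖v‖ < ρ ∧ inner ℝ v n > ‖v‖ * Real.cos θ}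

/-- The set of unit vectors `n` that are admissible at `x₀` for the set `Ω`. -/
def coneDirections (ρ θ : ℝ) (x₀ : Eucl N) (Ω : Set (Eucl N)) : Set (Eucl N) :=
  {n | ‖n‖ = 1 ∧
    (∀ v ∈ cone ρ θ n, ∀ y ∈ Metric.ball x₀ (3 * ρ) ∩ Ω, y - v ∈ Ω) ∧
    (∀ v ∈ cone ρ θ n, ∀ y ∈ Metric.ball x₀ (3 * ρ) \ Ω, y + v ∈ Ωᶜ)}

/-- The uniform `(ρ, θ)`-Lipschitz cone condition. -/
def LipschitzCone (ρ θ : ℝ) (Ω : Set (Eucl N)) : Prop :=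
  ∀ x₀ : Eucl N, (coneDirections ρ θ x₀ Ω).Nonempty

/-! ### The Besov spaces `B^r_{2,∞}` -/

/-- `g` is the `i`-th distributional partial derivative of `u` (both locally integrable). -/
def IsWeakPartial (i : Fin N) (u g : Eucl N → ℝ) : Prop :=
  LocallyIntegrable u volume ∧ LocallyIntegrable g volume ∧
    ∀ φ : Eucl N → ℝ, ContDiff ℝ ∞ φ → HasCompactSupport φ →
      ∫ x, u x * fderiv ℝ φ x (EuclideanSpace.single i 1) = -∫ x, g x * φ x

/-- `sup_{h ≠ 0} ‖u(· + 2h) - 2 u(· + h) + u‖_{L²} / |h|^r`. -/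
def secondDiffSeminorm (r : ℝ) (u : Eucl N → ℝ) : ENNReal :=
  ⨆ (h : Eucl N) (_ : h ≠ 0),
    eLpNorm (fun x => u (x + (2 : ℝ) • h) - 2 * u (x + h) + u x) 2 volume
      / ENNReal.ofReal (‖h‖ ^ r)

/-- The Besov norm of order `k + t`, where `k ∈ ℕ` and `t ∈ (0, 1]`, by recursion on `k`.
The infimum runs over the versions of the `i`-th distributional derivative;
it is `∞` if that derivative is not a function. -/
def besovNormAux (t : ℝ) : ℕ → (Eucl N → ℝ) → ENNReal
  | 0, u => eLpNorm u 2 volume + secondDiffSeminorm t u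
  | k + 1, u => eLpNorm u 2 volume +
      ∑ i : Fin N, ⨅ (g : Eucl N → ℝ) (_ : IsWeakPartial i u g), besovNormAux t k g

/-- The norm of `B^r_{2,∞}(ℝ^N)`, `r > 0`, with values in `[0, ∞]`:
the definition by second differences for `r ∈ (0, 1]`, and
`‖u‖_{L²} + ∑ᵢ ‖∂ᵢ u‖_{B^{r-1}_{2,∞}}` for `r > 1`. -/
def besovNorm (r : ℝ) (u : Eucl N → ℝ) : ENNReal :=
  besovNormAux (r - ((⌈r⌉₊ - 1 : ℕ) : ℝ)) (⌈r⌉₊ - 1) u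

/-- `u ∈ B^r_{2,∞}(ℝ^N)`, `r > 0`. -/
def MemBesov (r : ℝ) (u : Eucl N → ℝ) : Prop :=
  MemLp u 2 volume ∧ besovNorm r u < ⊤

theorem besovNorm_of_le_one {r : ℝ} (h0 : 0 < r) (h1 : r ≤ 1) (u : Eucl N → ℝ) :
    besovNorm r u = eLpNorm u 2 volume + secondDiffSeminorm r u := by
  have h : ⌈r⌉₊ = 1 := by
    rw [Nat.ceil_eq_iff one_ne_zero]; constructor <;> simpa
  simp [besovNorm, h, besovNormAux]

theorem besovNorm_of_one_lt {r : ℝ} (h1 : 1 < r) (u : Eucl N → ℝ) :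
    besovNorm r u = eLpNorm u 2 volume +
      ∑ i : Fin N, ⨅ (g : Eucl N → ℝ) (_ : IsWeakPartial i u g), besovNorm (r - 1) g := by
  obtain ⟨k, hk⟩ : ∃ k : ℕ, ⌈r⌉₊ = k + 2 := by
    have : 1 < ⌈r⌉₊ := Nat.lt_ceil.2 (by simpa using h1)
    exact ⟨⌈r⌉₊ - 2, by omega⟩
  have hk' : ⌈r - 1⌉₊ = k + 1 := by
    have := Nat.ceil_sub_one r
    omega
  have e : r - ((k + 1 : ℕ) : ℝ) = r - 1 - (k : ℝ) := by push_cast; ring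
  simp only [besovNorm, hk, hk', Nat.add_sub_cancel, Nat.add_succ_sub_one, e, besovNormAux]

end FracPoisson

end

/-! Write D_h u = u(· + h) - u, let [·] be the Gagliardo seminorm, and put E = [u]². The heart of
the matter is the bound [D_h u]² ≲ |h|^s (E + ‖f‖_{L²} √E) for small h. A first difference of step h
is controlled in L² by |h|^s times the seminorm (`lintegral_shiftDiff_sq_le`), so ‖D_h D_h u‖²_{L²}
≲ |h|^{2s} |h|^s, which is Besov order 3s/2.

In general D_h u is not an admissible test function. If h lies in a cone of directions pointing out
of Ω near x₀ and φ is a cutoff around x₀, then w = φ D_h u vanishes off Ω and is admissible.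
Moreover u + w = (1 - φ) u + φ u(· + h) is a pointwise convex combination. Convexity of the square
bounds [w]² + 2⟨u, w⟩ = [u + w]² - [u]² by the φ-weighted energy of u(· + h) minus that of u, up to
a commutator (`energy_cutoff_shiftDiff_le`). A change of variables moves the shift onto φ, so the
difference of energies is O(|h|) E; the commutator has norm O(|h|^s √E) and costs O(|h|^s E). The
equation turns ⟨u, w⟩ into a multiple of ∫ f w, which is at most ‖f‖ ‖D_h u‖ ≲ |h|^s ‖f‖ √E.

Every small h is a difference of two cone vectors of comparable length, so D_h u is locally a
difference of translates of such w; a finite cover yields the global bound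
(`exists_gagliardoSq_shiftDiff_le`).

Testing with u and using the Poincaré inequality gives √E ≲ ‖f‖_{H^{-s}} ≤ ‖f‖_{L²}, hence E +
‖f‖_{L²} √E ≲ ‖f‖_{H^{-s}} ‖f‖_{L²}. When 3s/2 > 1, the bound on second differences still has to be
converted into a bound on weak derivatives (`exists_besovNorm_le`). -/

namespace FracPoisson

open Set Filter Topology
open scoped ENNReal

/-! ### The kernel and the normalization constant -/

section Kernel

variable {N : ℕ} {s : ℝ}

theorem kernel_nonneg (z : Eucl N) : 0 ≤ kernel s z := Real.rpow_nonneg (norm_nonneg z) _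

theorem measurable_kernel : Measurable (kernel s : Eucl N → ℝ) := by
  unfold kernel
  fun_prop

theorem kernel_neg (z : Eucl N) : kernel s (-z) = kernel s z := by simp [kernel]

theorem one_le_mul_kernel (hs : 0 < s) {z : Eucl N} (hz : z ≠ 0) {R : ℝ} (hR : ‖z‖ ≤ R) :
    1 ≤ R ^ ((N : ℝ) + 2 * s) * kernel s z := by
  have h0 : 0 < ‖z‖ := norm_pos_iff.2 hz
  have hk : kernel s z = (‖z‖ ^ ((N : ℝ) + 2 * s))⁻¹ := by
    rw [kernel, ← Real.rpow_neg h0.le]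
    congr 1
    ring
  rw [hk, ← div_eq_mul_inv, one_le_div (by positivity)]
  exact Real.rpow_le_rpow h0.le hR (by positivity)

/-- The second moment of the kernel, truncated at infinity. -/
noncomputable def kernelMoment (N : ℕ) (s : ℝ) : ℝ≥0∞ :=
  ∫⁻ z : Eucl N, ENNReal.ofReal (min 1 (‖z‖ ^ 2) * kernel s z)

/-- In polar coordinates the integrand is t^(1-2s) near 0 and t^(-1-2s) near infinity; the first
needs s < 1, the second s > 0. -/
theorem integrable_min_mul_kernel [NeZero N] (hs0 : 0 < s) (hs1 : s < 1) :
    Integrable fun z : Eucl N => min 1 (‖z‖ ^ 2) * kernel s z := by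
  have hN : 1 ≤ N := Nat.one_le_iff_ne_zero.2 (NeZero.ne N)
  have : Nontrivial (Eucl N) := by
    apply Module.nontrivial_of_finrank_pos (R := ℝ)
    rw [finrank_euclideanSpace, Fintype.card_fin]
    exact hN
  have key := (integrable_fun_norm_addHaar (volume : Measure (Eucl N))
    (f := fun t : ℝ => min 1 (t ^ 2) * t ^ (-(N : ℝ) - 2 * s))).2 ?_
  · exact key
  have hpow : ∀ {t : ℝ} (e : ℝ), 0 < t → t ^ (N - 1) * t ^ e = t ^ ((N : ℝ) - 1 + e) := by
    intro t e ht
    rw [← Real.rpow_natCast, ← Real.rpow_add ht, Nat.cast_sub hN, Nat.cast_one]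
  rw [← Ioc_union_Ioi_eq_Ioi (zero_le_one (α := ℝ))]
  simp only [finrank_euclideanSpace, Fintype.card_fin, smul_eq_mul]
  refine IntegrableOn.union ?_ ?_
  · have h1 : IntegrableOn (fun t : ℝ => t ^ (1 - 2 * s)) (Ioc 0 1) := by
      rw [integrableOn_Ioc_iff_integrableOn_Ioo,
        intervalIntegral.integrableOn_Ioo_rpow_iff zero_lt_one]
      linarith
    refine h1.congr_fun (fun t ht => ?_) measurableSet_Ioc
    have h2 : min 1 (t ^ 2) = t ^ (2 : ℝ) := by
      rw [min_eq_right (pow_le_one₀ ht.1.le ht.2)]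
      norm_cast
    simp only
    rw [h2, ← Real.rpow_add ht.1, hpow _ ht.1]
    congr 1
    ring
  · have h1 : IntegrableOn (fun t : ℝ => t ^ (-1 - 2 * s)) (Ioi 1) := by
      rw [integrableOn_Ioi_rpow_iff zero_lt_one]
      linarith
    refine h1.congr_fun (fun t ht => ?_) measurableSet_Ioi
    have ht0 : 0 < t := zero_lt_one.trans ht
    have h2 : min 1 (t ^ 2) = 1 := min_eq_left (one_le_pow₀ (le_of_lt ht))
    simp only
    rw [h2, one_mul, hpow _ ht0]
    congr 1
    ring

theorem kernelMoment_lt_top [NeZero N] (hs0 : 0 < s) (hs1 : s < 1) : kernelMoment N s < ⊤ := by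
  have h := (integrable_min_mul_kernel (N := N) hs0 hs1).lintegral_lt_top
  exact h

/-- The Bochner integral of a non-integrable function is 0, which would make the constant 0 and the
left side of the weak equation trivial. Integrability is therefore part of the argument; positivity
comes from the slab 1 < x₀ < 2. -/
theorem normConst_pos [NeZero N] (hs0 : 0 < s) (hs1 : s < 1) : 0 < normConst N s := by
  have hk : ∀ x : Eucl N, (1 - Real.cos (x 0)) / ‖x‖ ^ ((N : ℝ) + 2 * s)
      = (1 - Real.cos (x 0)) * kernel s x := by
    intro x
    rw [kernel, div_eq_mul_inv, ← Real.rpow_neg (norm_nonneg x)]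
    congr 2
    ring
  have hnn : ∀ x : Eucl N, 0 ≤ (1 - Real.cos (x 0)) / ‖x‖ ^ ((N : ℝ) + 2 * s) := fun x =>
    div_nonneg (by linarith [Real.cos_le_one (x 0)]) (Real.rpow_nonneg (norm_nonneg x) _)
  have hint : Integrable fun x : Eucl N =>
      (1 - Real.cos (x 0)) / ‖x‖ ^ ((N : ℝ) + 2 * s) := by
    refine ((integrable_min_mul_kernel (N := N) hs0 hs1).const_mul 2).mono' ?_ ?_
    · refine Measurable.aestronglyMeasurable ?_
      fun_prop
    · refine Eventually.of_forall fun x => ?_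
      rw [Real.norm_of_nonneg (hnn x), hk, ← mul_assoc]
      refine mul_le_mul_of_nonneg_right ?_ (kernel_nonneg x)
      have h1 : (x 0) ^ 2 ≤ ‖x‖ ^ 2 := by
        have := PiLp.norm_apply_le x 0
        rw [← sq_abs]
        exact pow_le_pow_left₀ (abs_nonneg _) this 2
      have h2 := Real.one_sub_sq_div_two_le_cos (x := x 0)
      have h3 := Real.neg_one_le_cos (x 0)
      rcases min_cases 1 (‖x‖ ^ 2) with ⟨h, _⟩ | ⟨h, _⟩ <;> rw [h]
      · linarith
      · nlinarith [sq_nonneg ‖x‖]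
  refine inv_pos.2 ((integral_pos_iff_support_of_nonneg hnn hint).2 ?_)
  have hopen : IsOpen {x : Eucl N | x 0 ∈ Ioo 1 2} :=
    isOpen_Ioo.preimage (by fun_prop)
  refine (hopen.measure_pos volume ⟨EuclideanSpace.single 0 (3 / 2), ?_⟩).trans_le
    (measure_mono fun x hx => ?_)
  · simp
    norm_num
  · have h1 : x 0 ∈ Ioo (1 : ℝ) 2 := hx
    have hx0 : x ≠ 0 := by
      rintro rfl
      simp at h1
      exact absurd h1 (not_lt.2 zero_le_one)
    have hc : Real.cos (x 0) < 1 := by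
      have := Real.cos_lt_cos_of_nonneg_of_le_pi (x := 0) (y := x 0) le_rfl
        (by linarith [h1.2, Real.pi_gt_three]) (by linarith [h1.1])
      simpa using this
    have hp : 0 < ‖x‖ ^ ((N : ℝ) + 2 * s) := Real.rpow_pos_of_pos (norm_pos_iff.2 hx0) _
    exact (div_pos (by linarith) hp).ne'

end Kernel

/-! ### The Gagliardo measure and first differences in L² -/

section Gagliardo

variable {N : ℕ} {s : ℝ}

/-- The measure `K_s(x - y) dx dy`. -/
noncomputable def gagliardoMeasure (N : ℕ) (s : ℝ) : Measure (Eucl N × Eucl N) :=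
  volume.withDensity fun p => ENNReal.ofReal (kernel s (p.1 - p.2))

theorem measurable_kernel_sub :
    Measurable fun p : Eucl N × Eucl N => ENNReal.ofReal (kernel s (p.1 - p.2)) :=
  (measurable_kernel.comp (measurable_fst.sub measurable_snd)).ennreal_ofReal

theorem lintegral_gagliardoMeasure {F : Eucl N × Eucl N → ℝ≥0∞} (hF : Measurable F) :
    ∫⁻ p, F p ∂gagliardoMeasure N s = ∫⁻ p, ENNReal.ofReal (kernel s (p.1 - p.2)) * F p := by
  rw [gagliardoMeasure, lintegral_withDensity_eq_lintegral_mul _ measurable_kernel_sub hF]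
  rfl

theorem gagliardoSq_eq_lintegral {v : Eucl N → ℝ} (hv : Measurable v) :
    gagliardoSq s v = ∫⁻ p, ENNReal.ofReal ((v p.1 - v p.2) ^ 2) ∂gagliardoMeasure N s := by
  rw [lintegral_gagliardoMeasure (by fun_prop)]
  refine lintegral_congr fun p => ?_
  rw [← ENNReal.ofReal_mul (kernel_nonneg _), sq_abs]

theorem integral_gagliardoMeasure (F : Eucl N × Eucl N → ℝ) :
    ∫ p, F p ∂gagliardoMeasure N s = ∫ p : Eucl N × Eucl N, kernel s (p.1 - p.2) * F p := by
  rw [gagliardoMeasure, integral_withDensity_eq_integral_toReal_smul measurable_kernel_sub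
    (Eventually.of_forall fun _ => ENNReal.ofReal_lt_top)]
  refine integral_congr_ae (Eventually.of_forall fun p => ?_)
  simp only [smul_eq_mul, ENNReal.toReal_ofReal (kernel_nonneg _)]

theorem measurePreserving_shift (h : Eucl N) :
    MeasurePreserving (fun p : Eucl N × Eucl N => (p.1 + h, p.2 + h))
      (gagliardoMeasure N s) (gagliardoMeasure N s) := by
  have hm : Measurable fun p : Eucl N × Eucl N => (p.1 + h, p.2 + h) := by fun_prop
  refine ⟨hm, Measure.ext_of_lintegral _ fun F hF => ?_⟩
  rw [lintegral_map hF hm, lintegral_gagliardoMeasure (by fun_prop),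
    lintegral_gagliardoMeasure hF]
  have hadd := measurePreserving_add_right (volume : Measure (Eucl N)) h
  have := (hadd.prod hadd).lintegral_comp (measurable_kernel_sub (s := s).mul hF)
  rw [Measure.volume_eq_prod]
  refine Eq.trans (lintegral_congr fun p => ?_) this
  simp [Prod.map]

theorem lintegral_mul_comp_sub {m g : Eucl N → ℝ≥0∞} (hm : Measurable m) (hg : Measurable g) :
    ∫⁻ p : Eucl N × Eucl N, m (p.1 - p.2) * g p.2 = (∫⁻ z, m z) * ∫⁻ y, g y := by
  rw [Measure.volume_eq_prod, lintegral_prod_symm _ (by fun_prop), mul_comm,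
    ← lintegral_mul_const _ hg]
  refine lintegral_congr fun y => ?_
  simp only
  rw [lintegral_mul_const _ (by fun_prop), lintegral_sub_right_eq_self m y, mul_comm]

/-- Serves two kinds of weight that compensate the singularity on the diagonal: squared increments
of a cutoff, and the indicator of pairs far from the diagonal. -/
theorem lintegral_weight_mul_sq_snd_le {W : Eucl N × Eucl N → ℝ} {L : ℝ} {g : Eucl N → ℝ}
    (hW : Measurable W) (hg : Measurable g) (hL : 0 ≤ L)
    (hWL : ∀ p, W p ≤ L * min 1 (‖p.1 - p.2‖ ^ 2)) :
    ∫⁻ p, ENNReal.ofReal (W p * g p.2 ^ 2) ∂gagliardoMeasure N s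
      ≤ ENNReal.ofReal L * kernelMoment N s * ∫⁻ y, ENNReal.ofReal (g y ^ 2) := by
  rw [lintegral_gagliardoMeasure (by fun_prop)]
  have hk := measurable_kernel (N := N) (s := s)
  rw [kernelMoment, mul_assoc, ← lintegral_mul_comp_sub (by fun_prop) (by fun_prop),
    ← lintegral_const_mul _ (by fun_prop)]
  refine lintegral_mono fun p => ?_
  simp only
  rw [← ENNReal.ofReal_mul (kernel_nonneg _), ← ENNReal.ofReal_mul
    (mul_nonneg (by positivity) (kernel_nonneg _)), ← ENNReal.ofReal_mul hL]
  refine ENNReal.ofReal_le_ofReal ?_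
  calc kernel s (p.1 - p.2) * (W p * g p.2 ^ 2)
      ≤ kernel s (p.1 - p.2) * ((L * min 1 (‖p.1 - p.2‖ ^ 2)) * g p.2 ^ 2) := by
        gcongr
        · exact kernel_nonneg _
        · exact hWL p
    _ = _ := by ring

theorem measurePreserving_gagliardoMeasure_swap :
    MeasurePreserving Prod.swap (gagliardoMeasure N s) (gagliardoMeasure N s) := by
  refine ⟨measurable_swap, Measure.ext_of_lintegral _ fun F hF => ?_⟩
  rw [lintegral_map hF measurable_swap, lintegral_gagliardoMeasure (by fun_prop),
    lintegral_gagliardoMeasure hF]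
  have := (Measure.measurePreserving_swap (μ := (volume : Measure (Eucl N)))
    (ν := (volume : Measure (Eucl N)))).lintegral_comp (measurable_kernel_sub (s := s).mul hF)
  rw [Measure.volume_eq_prod]
  refine Eq.trans (lintegral_congr fun p => ?_) this
  simp only [Pi.mul_apply, Prod.fst_swap, Prod.snd_swap]
  rw [← kernel_neg, neg_sub]

theorem lintegral_weight_mul_sq_fst_le {W : Eucl N × Eucl N → ℝ} {L : ℝ} {g : Eucl N → ℝ}
    (hW : Measurable W) (hg : Measurable g) (hL : 0 ≤ L)
    (hWL : ∀ p, W p ≤ L * min 1 (‖p.1 - p.2‖ ^ 2)) :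
    ∫⁻ p, ENNReal.ofReal (W p * g p.1 ^ 2) ∂gagliardoMeasure N s
      ≤ ENNReal.ofReal L * kernelMoment N s * ∫⁻ y, ENNReal.ofReal (g y ^ 2) := by
  rw [← (measurePreserving_gagliardoMeasure_swap (N := N) (s := s)).lintegral_comp (by fun_prop)]
  refine lintegral_weight_mul_sq_snd_le (W := fun p => W p.swap) (by fun_prop) hg hL fun p => ?_
  have := hWL p.swap
  rwa [Prod.fst_swap, Prod.snd_swap, norm_sub_rev] at this

/-- The first difference `v(· + h) - v`. -/
def shiftDiff (h : Eucl N) (v : Eucl N → ℝ) (x : Eucl N) : ℝ := v (x + h) - v x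

theorem measurable_shiftDiff {v : Eucl N → ℝ} (hv : Measurable v) (h : Eucl N) :
    Measurable (shiftDiff h v) := by
  unfold shiftDiff
  fun_prop

/-- The constant in the estimate of first differences by the Gagliardo seminorm. -/
noncomputable def shiftConst (N : ℕ) (s : ℝ) : ℝ :=
  4 * 2 ^ ((N : ℝ) + 2 * s) / volume.real (Metric.ball (0 : Eucl N) 1)

theorem volume_real_ball_pos {r : ℝ} (hr : 0 < r) :
    0 < volume.real (Metric.ball (0 : Eucl N) r) :=
  ENNReal.toReal_pos (Metric.measure_ball_pos _ _ hr).ne' measure_ball_lt_top.ne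

theorem shiftConst_pos : 0 < shiftConst N s := by
  have := volume_real_ball_pos (N := N) one_pos
  unfold shiftConst
  positivity

/-- Compare v(x + h) and v(x) with v(y) and average over y in the ball of radius |h| about x. Both
distances are at most 2|h|, so the kernel is at least (2|h|)^(-N-2s) there; dividing by the volume
|h|^N of the ball leaves |h|^(2s). -/
theorem lintegral_shiftDiff_sq_le (hs : 0 < s) {v : Eucl N → ℝ} (hv : Measurable v)
    (h : Eucl N) :
    ∫⁻ x, ENNReal.ofReal (shiftDiff h v x ^ 2)
      ≤ ENNReal.ofReal (shiftConst N s * ‖h‖ ^ (2 * s)) * gagliardoSq s v := by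
  rcases eq_or_ne h 0 with rfl | hh
  · simp [shiftDiff]
  have hr : 0 < ‖h‖ := norm_pos_iff.2 hh
  set r := ‖h‖ with hr_def
  set G : Eucl N × Eucl N → ℝ≥0∞ := fun p =>
    ENNReal.ofReal (kernel s (p.1 - p.2) * |v p.1 - v p.2| ^ 2) with hG
  have hGm : Measurable G := by
    have hk := measurable_kernel (N := N) (s := s)
    fun_prop
  set c : ℝ := (2 * r) ^ ((N : ℝ) + 2 * s) with hc
  have hc0 : 0 < c := by positivity
  have hpt : ∀ a b : Eucl N, ‖a - b‖ ≤ 2 * r →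
      ENNReal.ofReal ((v a - v b) ^ 2) ≤ ENNReal.ofReal c * G (a, b) := by
    intro a b hab
    rcases eq_or_ne a b with rfl | hne
    · simp
    rw [hG, ← ENNReal.ofReal_mul hc0.le]
    refine ENNReal.ofReal_le_ofReal ?_
    have := one_le_mul_kernel hs (sub_ne_zero.2 hne) hab
    simp only [sq_abs]
    rw [← mul_assoc]
    exact le_mul_of_one_le_left (sq_nonneg _) this
  have hx : ∀ x y : Eucl N, y ∈ Metric.ball x r → ENNReal.ofReal (shiftDiff h v x ^ 2)
      ≤ ENNReal.ofReal (2 * c) * (G (x + h, y) + G (x, y)) := by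
    intro x y hy
    rw [Metric.mem_ball, dist_eq_norm, norm_sub_rev] at hy
    have h1 := hpt (x + h) y (by
      have : x + h - y = (x - y) + h := by abel
      rw [this]
      linarith [norm_add_le (x - y) h])
    have h2 := hpt x y (by linarith)
    calc ENNReal.ofReal (shiftDiff h v x ^ 2)
        ≤ ENNReal.ofReal (2 * ((v (x + h) - v y) ^ 2 + (v x - v y) ^ 2)) := by
          refine ENNReal.ofReal_le_ofReal ?_
          rw [shiftDiff]
          nlinarith [sq_nonneg ((v (x + h) - v y) + (v x - v y))]
      _ = ENNReal.ofReal 2 * (ENNReal.ofReal ((v (x + h) - v y) ^ 2)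
            + ENNReal.ofReal ((v x - v y) ^ 2)) := by
          rw [ENNReal.ofReal_mul two_pos.le, ENNReal.ofReal_add (sq_nonneg _) (sq_nonneg _)]
      _ ≤ ENNReal.ofReal 2 * (ENNReal.ofReal c * G (x + h, y) + ENNReal.ofReal c * G (x, y)) := by
          gcongr
      _ = _ := by rw [← mul_add, ← mul_assoc, ← ENNReal.ofReal_mul two_pos.le]
  have hball : ∀ x : Eucl N, volume (Metric.ball x r) = ENNReal.ofReal
      (r ^ N * volume.real (Metric.ball (0 : Eucl N) 1)) := by
    intro x
    rw [Measure.addHaar_ball_of_pos _ _ hr, finrank_euclideanSpace, Fintype.card_fin,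
      ENNReal.ofReal_mul (by positivity), ofReal_measureReal]
  set V : ℝ := volume.real (Metric.ball (0 : Eucl N) 1) with hV
  have hV0 : 0 < V := volume_real_ball_pos one_pos
  have hav : ∀ x : Eucl N, ENNReal.ofReal (r ^ N * V) * ENNReal.ofReal (shiftDiff h v x ^ 2)
      ≤ ENNReal.ofReal (2 * c) * ((∫⁻ y, G (x + h, y)) + ∫⁻ y, G (x, y)) := by
    intro x
    calc ENNReal.ofReal (r ^ N * V) * ENNReal.ofReal (shiftDiff h v x ^ 2)
        = ∫⁻ _ in Metric.ball x r, ENNReal.ofReal (shiftDiff h v x ^ 2) := by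
          rw [setLIntegral_const, hball, mul_comm]
      _ ≤ ∫⁻ y in Metric.ball x r, ENNReal.ofReal (2 * c) * (G (x + h, y) + G (x, y)) :=
          setLIntegral_mono (by fun_prop) (hx x)
      _ ≤ ∫⁻ y, ENNReal.ofReal (2 * c) * (G (x + h, y) + G (x, y)) := setLIntegral_le_lintegral _ _
      _ = _ := by
          rw [lintegral_const_mul _ (by fun_prop), lintegral_add_left (by fun_prop)]
  have hE : ∫⁻ x, ∫⁻ y, G (x, y) = gagliardoSq s v := by
    rw [gagliardoSq, Measure.volume_eq_prod, lintegral_prod _ hGm.aemeasurable]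
  have hIm : Measurable fun x => ∫⁻ y, G (x, y) := hGm.lintegral_prod_right'
  have hEh : ∫⁻ x, ∫⁻ y, G (x + h, y) = gagliardoSq s v := by
    rw [← hE]
    exact lintegral_add_right_eq_self (fun x => ∫⁻ y, G (x, y)) h
  have hsum : ENNReal.ofReal (r ^ N * V) * ∫⁻ x, ENNReal.ofReal (shiftDiff h v x ^ 2)
      ≤ ENNReal.ofReal (4 * c) * gagliardoSq s v := by
    have hd := measurable_shiftDiff hv h
    rw [← lintegral_const_mul _ (by fun_prop)]
    refine (lintegral_mono hav).trans_eq ?_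
    rw [lintegral_const_mul _ (by fun_prop), lintegral_add_right _ hIm, hE, hEh, ← two_mul,
      ← mul_assoc]
    congr 1
    rw [show (4 : ℝ) * c = 2 * c * 2 by ring, ENNReal.ofReal_mul (q := 2) (by positivity)]
    simp
  have hpos : 0 < r ^ N * V := by positivity
  have hcr : shiftConst N s * r ^ (2 * s) = (r ^ N * V)⁻¹ * (4 * c) := by
    rw [shiftConst, hc, ← hV, Real.mul_rpow two_pos.le hr.le, Real.rpow_add hr, Real.rpow_natCast]
    field_simp
  rw [hcr, ENNReal.ofReal_mul (by positivity), mul_assoc]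
  calc ∫⁻ x, ENNReal.ofReal (shiftDiff h v x ^ 2)
      = ENNReal.ofReal (r ^ N * V)⁻¹ * (ENNReal.ofReal (r ^ N * V) *
          ∫⁻ x, ENNReal.ofReal (shiftDiff h v x ^ 2)) := by
        rw [← mul_assoc, ← ENNReal.ofReal_mul (by positivity), inv_mul_cancel₀ hpos.ne']
        simp
    _ ≤ _ := by gcongr

end Gagliardo

/-! ### Convexity estimate for the energy of a localized difference -/

section Energy

variable {N : ℕ} {s : ℝ}

/-- The increment `v(x) - v(y)`. -/
def incr (v : Eucl N → ℝ) (p : Eucl N × Eucl N) : ℝ := v p.1 - v p.2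

theorem measurable_incr {v : Eucl N → ℝ} (hv : Measurable v) : Measurable (incr v) := by
  unfold incr
  fun_prop

theorem lintegral_ofReal_sq_lt_top_iff {α : Type*} [MeasurableSpace α] {μ : Measure α}
    {g : α → ℝ} (hg : Measurable g) :
    ∫⁻ a, ENNReal.ofReal (g a ^ 2) ∂μ < ⊤ ↔ MemLp g 2 μ := by
  rw [memLp_two_iff_integrable_sq hg.aestronglyMeasurable,
    ← hasFiniteIntegral_iff_ofReal (Eventually.of_forall fun a => sq_nonneg (g a))]
  exact ⟨fun h => ⟨by fun_prop, h⟩, fun h => h.2⟩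

theorem integral_sq_eq_toReal {α : Type*} [MeasurableSpace α] {μ : Measure α}
    {g : α → ℝ} (hg : Measurable g) :
    ∫ a, g a ^ 2 ∂μ = (∫⁻ a, ENNReal.ofReal (g a ^ 2) ∂μ).toReal :=
  integral_eq_lintegral_of_nonneg_ae (Eventually.of_forall fun a => sq_nonneg (g a)) (by fun_prop)

theorem eLpNorm_two_sq_eq {α : Type*} [MeasurableSpace α] {μ : Measure α} (g : α → ℝ) :
    eLpNorm g 2 μ ^ 2 = ∫⁻ a, ENNReal.ofReal (g a ^ 2) ∂μ := by
  have h := eLpNorm_nnreal_pow_eq_lintegral (μ := μ) (f := g) (p := 2) two_ne_zero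
  have h2 : ((2 : NNReal) : ℝ) = ((2 : ℕ) : ℝ) := by norm_num
  rw [h2, ENNReal.rpow_natCast] at h
  refine h.trans (lintegral_congr fun a => ?_)
  rw [ENNReal.rpow_natCast, Real.enorm_eq_ofReal_abs, ← ENNReal.ofReal_pow (abs_nonneg _), sq_abs]

theorem memLp_incr_iff {v : Eucl N → ℝ} (hv : Measurable v) :
    MemLp (incr v) 2 (gagliardoMeasure N s) ↔ gagliardoSq s v < ⊤ := by
  rw [gagliardoSq_eq_lintegral hv, ← lintegral_ofReal_sq_lt_top_iff (measurable_incr hv)]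
  rfl

theorem integral_incr_sq {v : Eucl N → ℝ} (hv : Measurable v) :
    ∫ p, incr v p ^ 2 ∂gagliardoMeasure N s = (gagliardoSq s v).toReal := by
  rw [gagliardoSq_eq_lintegral hv, integral_sq_eq_toReal (measurable_incr hv)]
  rfl

/-- The left side is (m + R)² - B² with m = aA + (1-a)B. Convexity gives m² ≤ aA² + (1-a)B², and
Young's inequality with parameter t absorbs the cross term 2Rm. -/
theorem convex_sq_expansion_le {a A B R t : ℝ} (ha0 : 0 ≤ a) (ha1 : a ≤ 1) (ht : 0 < t) :
    (a * (A - B) + R) ^ 2 + 2 * (B * (a * (A - B) + R))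
      ≤ a * A ^ 2 - a * B ^ 2 + ((2 * t⁻¹ + 1) * R ^ 2 + (t * A ^ 2 + t * B ^ 2)) := by
  have h1 : ∀ X : ℝ, 2 * (R * X) ≤ t⁻¹ * R ^ 2 + t * X ^ 2 := by
    intro X
    have : t⁻¹ * R ^ 2 + t * X ^ 2 - 2 * (R * X) = t⁻¹ * (R - t * X) ^ 2 := by
      field_simp
      ring
    have h2 : 0 ≤ t⁻¹ * (R - t * X) ^ 2 := by positivity
    linarith
  have hA := mul_le_mul_of_nonneg_left (h1 A) ha0
  have hB := mul_le_mul_of_nonneg_left (h1 B) (sub_nonneg.2 ha1)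
  have e1 : 0 ≤ a * (1 - a) * (A - B) ^ 2 :=
    mul_nonneg (mul_nonneg ha0 (sub_nonneg.2 ha1)) (sq_nonneg _)
  have e2 : 0 ≤ t⁻¹ * R ^ 2 := by positivity
  have e3 : 0 ≤ (1 - a) * (t * A ^ 2) := mul_nonneg (sub_nonneg.2 ha1) (by positivity)
  have e4 : 0 ≤ a * (t * B ^ 2) := by positivity
  nlinarith

/-- A cutoff function with values in `[0, 1]` and Lipschitz constant `ℓ`. -/
structure IsCutoff (ℓ : ℝ) (φ : Eucl N → ℝ) : Prop where
  measurable : Measurable φ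
  nonneg : ∀ x, 0 ≤ φ x
  le_one : ∀ x, φ x ≤ 1
  lipschitz : ∀ x y, |φ x - φ y| ≤ ℓ * ‖x - y‖

theorem IsCutoff.sq_sub_le {ℓ : ℝ} {φ : Eucl N → ℝ} (hφ : IsCutoff ℓ φ) (x y : Eucl N) :
    (φ x - φ y) ^ 2 ≤ (1 + ℓ ^ 2) * min 1 (‖x - y‖ ^ 2) := by
  have h1 : (φ x - φ y) ^ 2 ≤ 1 := by
    rw [sq_le_one_iff_abs_le_one, abs_le]
    constructor <;> linarith [hφ.nonneg x, hφ.le_one x, hφ.nonneg y, hφ.le_one y]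
  have h2 : (φ x - φ y) ^ 2 ≤ ℓ ^ 2 * ‖x - y‖ ^ 2 := by
    rw [← sq_abs, ← mul_pow]
    exact pow_le_pow_left₀ (abs_nonneg _) (hφ.lipschitz x y) 2
  rcases min_cases 1 (‖x - y‖ ^ 2) with ⟨h, _⟩ | ⟨h, _⟩ <;> rw [h]
  · nlinarith [sq_nonneg ℓ]
  · nlinarith [sq_nonneg ‖x - y‖]

variable {u φ : Eucl N → ℝ} {ℓ : ℝ}

theorem MemLp.bounded_mul {α : Type*} [MeasurableSpace α] {μ : Measure α} {a g : α → ℝ}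
    (hg : MemLp g 2 μ) (ha : Measurable a) (h0 : ∀ x, 0 ≤ a x) (h1 : ∀ x, a x ≤ 1) :
    MemLp (fun x => a x * g x) 2 μ := by
  refine hg.mono (ha.aestronglyMeasurable.mul hg.1) (Eventually.of_forall fun x => ?_)
  rw [norm_mul, Real.norm_of_nonneg (h0 x)]
  exact mul_le_of_le_one_left (norm_nonneg _) (h1 x)

theorem memLp_shiftDiff (hu : MemLp u 2 volume) (h : Eucl N) :
    MemLp (shiftDiff h u) 2 volume :=
  (hu.comp_measurePreserving (measurePreserving_add_right volume h)).sub hu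

theorem integral_shiftDiff_sq_le (hs : 0 < s) (hm : Measurable u) (hE : gagliardoSq s u < ⊤)
    (h : Eucl N) :
    ∫ x, shiftDiff h u x ^ 2 ≤ shiftConst N s * ‖h‖ ^ (2 * s) * (gagliardoSq s u).toReal := by
  rw [integral_sq_eq_toReal (measurable_shiftDiff hm h)]
  have hc : 0 ≤ shiftConst N s * ‖h‖ ^ (2 * s) :=
    mul_nonneg shiftConst_pos.le (Real.rpow_nonneg (norm_nonneg _) _)
  have := ENNReal.toReal_mono (ENNReal.mul_lt_top ENNReal.ofReal_lt_top hE).ne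
    (lintegral_shiftDiff_sq_le hs hm h)
  rwa [ENNReal.toReal_mul, ENNReal.toReal_ofReal hc] at this

/-- A bounded Lipschitz cutoff has squared increments O(min(1, |x-y|²)), which is integrable against
the kernel; only the L² norm of g is then needed. -/
theorem memLp_commutator [NeZero N] (hs0 : 0 < s) (hs1 : s < 1) (hφ : IsCutoff ℓ φ)
    {g : Eucl N → ℝ} (hgm : Measurable g) (hg : MemLp g 2 volume) :
    MemLp (fun p : Eucl N × Eucl N => (φ p.1 - φ p.2) * g p.2) 2 (gagliardoMeasure N s) ∧
    ∫ p, ((φ p.1 - φ p.2) * g p.2) ^ 2 ∂gagliardoMeasure N s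
      ≤ (1 + ℓ ^ 2) * (kernelMoment N s).toReal * ∫ x, g x ^ 2 := by
  have hφm := hφ.measurable
  have hmeas : Measurable fun p : Eucl N × Eucl N => (φ p.1 - φ p.2) * g p.2 := by fun_prop
  have hle := lintegral_weight_mul_sq_snd_le (s := s)
    (W := fun p : Eucl N × Eucl N => (φ p.1 - φ p.2) ^ 2) (L := 1 + ℓ ^ 2) (g := g)
    (by fun_prop) hgm (by positivity) fun p => hφ.sq_sub_le _ _
  simp only [← mul_pow] at hle
  have hg2 : ∫⁻ y, ENNReal.ofReal (g y ^ 2) < ⊤ := (lintegral_ofReal_sq_lt_top_iff hgm).2 hg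
  have hfin := ENNReal.mul_lt_top (ENNReal.mul_lt_top (ENNReal.ofReal_lt_top (r := 1 + ℓ ^ 2))
    (kernelMoment_lt_top (N := N) hs0 hs1)) hg2
  refine ⟨(lintegral_ofReal_sq_lt_top_iff hmeas).1 (hle.trans_lt hfin), ?_⟩
  rw [integral_sq_eq_toReal hmeas, integral_sq_eq_toReal hgm]
  have := ENNReal.toReal_mono hfin.ne hle
  rwa [ENNReal.toReal_mul, ENNReal.toReal_mul, ENNReal.toReal_ofReal (by positivity)] at this

theorem integral_comp_shift {F : Eucl N × Eucl N → ℝ} (hF : Measurable F) (h : Eucl N) :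
    ∫ p, F (p.1 + h, p.2 + h) ∂gagliardoMeasure N s = ∫ p, F p ∂gagliardoMeasure N s := by
  have hmp := measurePreserving_shift (N := N) (s := s) h
  conv_rhs => rw [← hmp.map_eq]
  rw [integral_map hmp.measurable.aemeasurable hF.aestronglyMeasurable]

/-- The energy of a localized difference. -/
theorem energy_cutoff_shiftDiff_le [NeZero N] (hs0 : 0 < s) (hs1 : s < 1) (hφ : IsCutoff ℓ φ)
    (hm : Measurable u) (hu : MemSobolev s u) {h : Eucl N} (hh : h ≠ 0) :
    MemSobolev s (fun x => φ x * shiftDiff h u x) ∧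
    ∫ p, incr (fun x => φ x * shiftDiff h u x) p ^ 2 ∂gagliardoMeasure N s
      ≤ (ℓ * ‖h‖ + 2 * ‖h‖ ^ s + (2 + ‖h‖ ^ s) * ‖h‖ ^ s *
          ((1 + ℓ ^ 2) * (kernelMoment N s).toReal * shiftConst N s)) * (gagliardoSq s u).toReal
        - 2 * ∫ p, incr u p * incr (fun x => φ x * shiftDiff h u x) p ∂gagliardoMeasure N s := by
  set ν := gagliardoMeasure N s with hν
  set w : Eucl N → ℝ := fun x => φ x * shiftDiff h u x with hw
  have hφm := hφ.measurable
  have hDm := measurable_shiftDiff hm h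
  have hwm : Measurable w := hφm.mul hDm
  set A : Eucl N × Eucl N → ℝ := fun p => incr u (p.1 + h, p.2 + h) with hA
  set B : Eucl N × Eucl N → ℝ := incr u with hB
  set R : Eucl N × Eucl N → ℝ := fun p => (φ p.1 - φ p.2) * shiftDiff h u p.2 with hR
  have hBm : Measurable B := measurable_incr hm
  have hB2 : MemLp B 2 ν := (memLp_incr_iff hm).2 hu.2
  have hA2 : MemLp A 2 ν := hB2.comp_measurePreserving (measurePreserving_shift h)
  obtain ⟨hR2, hRle⟩ := memLp_commutator (s := s) hs0 hs1 hφ hDm (memLp_shiftDiff hu.1 h)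
  -- Leibniz rule for increments: φ is evaluated at the first point only, and R collects the error.
  have hwe : incr w = fun p => φ p.1 * (A p - B p) + R p := by
    funext p
    simp only [hw, hA, hB, hR, incr, shiftDiff]
    ring
  have hφA : MemLp (fun p : Eucl N × Eucl N => φ p.1 * (A p - B p)) 2 ν :=
    MemLp.bounded_mul (hA2.sub hB2) (by fun_prop) (fun _ => hφ.nonneg _) fun _ => hφ.le_one _
  have hw2 : MemLp (incr w) 2 ν := by
    rw [hwe]
    exact hφA.add hR2
  have hwL : MemLp w 2 volume :=
    MemLp.bounded_mul (memLp_shiftDiff hu.1 h) hφm hφ.nonneg hφ.le_one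
  refine ⟨⟨hwL, (memLp_incr_iff hwm).1 hw2⟩, ?_⟩
  have ht : 0 < ‖h‖ ^ s := Real.rpow_pos_of_pos (norm_pos_iff.2 hh) _
  -- As Young parameter this balances the two errors: ∫ R² is O(t² E), so t⁻¹ ∫ R² and t ∫ (A² + B²)
  -- are both O(t E).
  set t := ‖h‖ ^ s with ht_def
  set E := (gagliardoSq s u).toReal with hE
  have iB : Integrable (fun p => B p ^ 2) ν := hB2.integrable_sq
  have iA : Integrable (fun p => A p ^ 2) ν := hA2.integrable_sq
  have iR : Integrable (fun p => R p ^ 2) ν := hR2.integrable_sq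
  have iw : Integrable (fun p => incr w p ^ 2) ν := hw2.integrable_sq
  have iBw : Integrable (fun p => B p * incr w p) ν := hB2.integrable_mul hw2
  have ibdd : ∀ {a X : Eucl N × Eucl N → ℝ}, Measurable a → (∀ p, 0 ≤ a p) → (∀ p, a p ≤ 1) →
      Integrable X ν → Integrable (fun p => a p * X p) ν := by
    intro a X ha h0 h1 hX
    refine hX.mono (ha.aestronglyMeasurable.mul hX.1) (Eventually.of_forall fun x => ?_)
    rw [norm_mul, Real.norm_of_nonneg (h0 x)]
    exact mul_le_of_le_one_left (norm_nonneg _) (h1 x)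
  have iφA : Integrable (fun p => φ p.1 * A p ^ 2) ν :=
    ibdd (by fun_prop) (fun _ => hφ.nonneg _) (fun _ => hφ.le_one _) iA
  have iφB : Integrable (fun p => φ p.1 * B p ^ 2) ν :=
    ibdd (by fun_prop) (fun _ => hφ.nonneg _) (fun _ => hφ.le_one _) iB
  have iφB' : Integrable (fun p : Eucl N × Eucl N => φ (p.1 - h) * B p ^ 2) ν :=
    ibdd (by fun_prop) (fun _ => hφ.nonneg _) (fun _ => hφ.le_one _) iB
  have eB : ∫ p, B p ^ 2 ∂ν = E := integral_incr_sq hm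
  have eA : ∫ p, A p ^ 2 ∂ν = E := by
    rw [← eB]
    exact integral_comp_shift (F := fun p => B p ^ 2) (by fun_prop) h
  have eφ : ∫ p, φ p.1 * A p ^ 2 ∂ν - ∫ p, φ p.1 * B p ^ 2 ∂ν ≤ ℓ * ‖h‖ * E := by
    -- Translation invariance of the measure puts the shift on the Lipschitz factor φ, so no
    -- regularity of u is spent.
    have e1 : ∫ p, φ p.1 * A p ^ 2 ∂ν = ∫ p : Eucl N × Eucl N, φ (p.1 - h) * B p ^ 2 ∂ν := by
      rw [← integral_comp_shift (F := fun p => φ (p.1 - h) * B p ^ 2) (by fun_prop) h]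
      simp only [add_sub_cancel_right]
      rfl
    rw [e1, ← integral_sub iφB' iφB, ← eB, ← integral_const_mul]
    refine integral_mono (iφB'.sub iφB) (iB.const_mul _) fun p => ?_
    have h1 := (le_abs_self _).trans (hφ.lipschitz (p.1 - h) p.1)
    rw [sub_sub_cancel_left, norm_neg] at h1
    simp only
    rw [← sub_mul]
    exact mul_le_mul_of_nonneg_right h1 (sq_nonneg _)
  have eR : ∫ p, R p ^ 2 ∂ν ≤
      (1 + ℓ ^ 2) * (kernelMoment N s).toReal * shiftConst N s * t ^ 2 * E := by
    refine hRle.trans ?_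
    have h1 := integral_shiftDiff_sq_le hs0 hm hu.2 h
    have h2 : ‖h‖ ^ (2 * s) = t ^ 2 := by
      rw [ht_def, mul_comm, Real.rpow_mul (norm_nonneg _)]
      norm_cast
    rw [h2] at h1
    calc _ ≤ (1 + ℓ ^ 2) * (kernelMoment N s).toReal * (shiftConst N s * t ^ 2 * E) := by
          gcongr
      _ = _ := by ring
  have key : ∫ p, (incr w p ^ 2 + 2 * (B p * incr w p)) ∂ν ≤
      ∫ p, (φ p.1 * A p ^ 2 - φ p.1 * B p ^ 2
        + ((2 * t⁻¹ + 1) * R p ^ 2 + (t * A p ^ 2 + t * B p ^ 2))) ∂ν := by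
    refine integral_mono (iw.add (iBw.const_mul 2)) ((iφA.sub iφB).add ((iR.const_mul _).add
      ((iA.const_mul t).add (iB.const_mul t)))) fun p => ?_
    simp only [hwe]
    exact convex_sq_expansion_le (hφ.nonneg _) (hφ.le_one _) ht
  have i1 : Integrable (fun p => t * A p ^ 2 + t * B p ^ 2) ν :=
    (iA.const_mul t).add (iB.const_mul t)
  have i2 : Integrable (fun p => (2 * t⁻¹ + 1) * R p ^ 2) ν := iR.const_mul _
  have i3 : Integrable (fun p => (2 * t⁻¹ + 1) * R p ^ 2 + (t * A p ^ 2 + t * B p ^ 2)) ν :=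
    i2.add i1
  have i4 : Integrable (fun p => φ p.1 * A p ^ 2 - φ p.1 * B p ^ 2) ν := iφA.sub iφB
  rw [integral_add iw (iBw.const_mul 2), integral_const_mul, integral_add i4 i3,
    integral_add i2 i1, integral_add (iA.const_mul t) (iB.const_mul t), integral_sub iφA iφB,
    integral_const_mul, integral_const_mul, integral_const_mul, eA, eB] at key
  have h3 : (2 * t⁻¹ + 1) * ∫ p, R p ^ 2 ∂ν ≤ (2 + t) * t *
      ((1 + ℓ ^ 2) * (kernelMoment N s).toReal * shiftConst N s) * E := by
    calc _ ≤ (2 * t⁻¹ + 1) *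
          ((1 + ℓ ^ 2) * (kernelMoment N s).toReal * shiftConst N s * t ^ 2 * E) := by gcongr
      _ = _ := by field_simp
  linarith

end Energy

/-! ### Localized regularity in cone directions -/

section Regularity

variable {N : ℕ} {s : ℝ}

theorem enorm_integral_mul_le {f w : Eucl N → ℝ} (hf : MemLp f 2 volume)
    (hw : MemLp w 2 volume) :
    ‖∫ x, f x * w x‖ₑ ≤ eLpNorm f 2 volume * eLpNorm w 2 volume := by
  refine (enorm_integral_le_lintegral_enorm _).trans ?_
  have h : eLpNorm (f • w) 1 volume ≤ eLpNorm f 2 volume * eLpNorm w 2 volume :=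
    eLpNorm_smul_le_mul_eLpNorm hw.1 hf.1
  rwa [eLpNorm_one_eq_lintegral_enorm] at h

theorem abs_integral_mul_le {f w : Eucl N → ℝ} (hf : MemLp f 2 volume) (hwm : Measurable w)
    (hw : MemLp w 2 volume) :
    |∫ x, f x * w x| ≤ (eLpNorm f 2 volume).toReal * √(∫ x, w x ^ 2) := by
  have h := ENNReal.toReal_mono (ENNReal.mul_lt_top hf.2 hw.2).ne (enorm_integral_mul_le hf hw)
  rw [toReal_enorm, ENNReal.toReal_mul, Real.norm_eq_abs] at h
  rwa [integral_sq_eq_toReal hwm, ← eLpNorm_two_sq_eq, ENNReal.toReal_pow,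
    Real.sqrt_sq ENNReal.toReal_nonneg]

/-- The radial cutoff that is `1` on `B_ρ(x₀)` and `0` outside `B_{2ρ}(x₀)`. -/
noncomputable def radialCutoff (ρ : ℝ) (x₀ x : Eucl N) : ℝ := max 0 (min 1 (2 - ‖x - x₀‖ / ρ))

theorem isCutoff_radialCutoff {ρ : ℝ} (hρ : 0 < ρ) (x₀ : Eucl N) :
    IsCutoff ρ⁻¹ (radialCutoff ρ x₀) where
  measurable := by
    unfold radialCutoff
    fun_prop
  nonneg x := le_max_left _ _
  le_one x := max_le zero_le_one (min_le_left _ _)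
  lipschitz x y := by
    unfold radialCutoff
    refine (abs_max_sub_max_le_max _ _ _ _).trans ?_
    rw [sub_self, abs_zero, max_eq_right (abs_nonneg _)]
    refine (abs_min_sub_min_le_max _ _ _ _).trans ?_
    rw [sub_self, abs_zero, max_eq_right (abs_nonneg _), sub_sub_sub_cancel_left, ← sub_div,
      abs_div, abs_of_pos hρ, div_eq_inv_mul]
    gcongr
    rw [norm_sub_rev x y]
    refine (abs_norm_sub_norm_le _ _).trans_eq ?_
    congr 1
    abel

theorem radialCutoff_eq_one {ρ : ℝ} (hρ : 0 < ρ) {x₀ x : Eucl N} (hx : x ∈ Metric.ball x₀ ρ) :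
    radialCutoff ρ x₀ x = 1 := by
  rw [Metric.mem_ball, dist_eq_norm] at hx
  have : ‖x - x₀‖ / ρ ≤ 1 := (div_le_one hρ).2 hx.le
  rw [radialCutoff, min_eq_left (by linarith), max_eq_right zero_le_one]

theorem radialCutoff_eq_zero {ρ : ℝ} (hρ : 0 < ρ) {x₀ x : Eucl N}
    (hx : x ∉ Metric.ball x₀ (2 * ρ)) : radialCutoff ρ x₀ x = 0 := by
  rw [Metric.mem_ball, dist_eq_norm, not_lt] at hx
  have : 2 ≤ ‖x - x₀‖ / ρ := (le_div_iff₀ hρ).2 hx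
  rw [radialCutoff, max_eq_left]
  exact (min_le_right _ _).trans (by linarith)

/-- The quantity `‖u‖_s² + ‖f‖_{L²} ‖u‖_s`. -/
noncomputable def dataEnergy (s : ℝ) (f u : Eucl N → ℝ) : ℝ :=
  (gagliardoSq s u).toReal + (eLpNorm f 2 volume).toReal * √(gagliardoSq s u).toReal

theorem dataEnergy_nonneg (f u : Eucl N → ℝ) : 0 ≤ dataEnergy s f u := by
  unfold dataEnergy
  positivity

theorem rpow_two_mul_eq_sq {x : ℝ} (hx : 0 ≤ x) : x ^ (2 * s) = (x ^ s) ^ 2 := by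
  rw [mul_comm, Real.rpow_mul hx]
  norm_cast

/-- The localized difference may be inserted in the weak equation because h points out of Ω, so the
cross term of the energy estimate becomes an integral against f. The constant is fixed before θ, Ω,
f and u. -/
theorem exists_gagliardoSq_localized_le (N : ℕ) [NeZero N] {s ρ : ℝ} (hs0 : 0 < s) (hs1 : s < 1)
    (hρ : 0 < ρ) : ∃ C : ℝ, 0 ≤ C ∧ ∀ (θ : ℝ) (Ω : Set (Eucl N)) (f u : Eucl N → ℝ),
      MemLp f 2 volume → Measurable u → (∀ x, x ∉ Ω → u x = 0) → IsWeakSolution s Ω f u →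
      ∀ x₀ : Eucl N, ∀ n ∈ coneDirections ρ θ x₀ Ω, ∀ h ∈ cone ρ θ n,
        gagliardoSq s (fun x => radialCutoff ρ x₀ x * shiftDiff h u x)
          ≤ ENNReal.ofReal (C * ‖h‖ ^ s * dataEnergy s f u) := by
  set c := normConst N s with hc
  have hc0 : 0 < c := normConst_pos hs0 hs1
  set S := shiftConst N s with hS
  have hS0 : 0 < S := shiftConst_pos
  set κ := (1 + ρ⁻¹ ^ 2) * (kernelMoment N s).toReal * S with hκ
  have hκ0 : 0 ≤ κ := by positivity
  set C₁ := ρ⁻¹ * ρ ^ (1 - s) + 2 + (2 + ρ ^ s) * κ with hC₁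
  have hC₁0 : 0 ≤ C₁ := by positivity
  refine ⟨C₁ + 2 * (c⁻¹ * √S), by positivity, ?_⟩
  intro θ Ω f u hf hm hu0 hu x₀ n hn h hh
  obtain ⟨hh0, hhρ, -⟩ := id hh
  have hhne : h ≠ 0 := norm_pos_iff.1 hh0
  set φ := radialCutoff ρ x₀ with hφ_def
  have hφ := isCutoff_radialCutoff hρ x₀
  obtain ⟨hwS, hle⟩ := energy_cutoff_shiftDiff_le hs0 hs1 hφ hm hu.1.1 hhne
  set w : Eucl N → ℝ := fun x => φ x * shiftDiff h u x with hw
  have hDm := measurable_shiftDiff hm h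
  have hwm : Measurable w := hφ.measurable.mul hDm
  have hw0 : MemX0 s Ω w := by
    refine ⟨hwS, Eventually.of_forall fun x hx => ?_⟩
    by_cases hxb : x ∈ Metric.ball x₀ (2 * ρ)
    -- The exterior half of the cone condition: the support ball of radius 2ρ lies inside the ball
    -- of radius 3ρ where it holds.
    · have h1 : x + h ∉ Ω := hn.2.2 h hh x
        ⟨Metric.ball_subset_ball (by linarith) hxb, hx⟩
      simp [hw, shiftDiff, hu0 x hx, hu0 _ h1]
    · have : φ x = 0 := radialCutoff_eq_zero hρ hxb
      simp [hw, this]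
  have hweak := hu.2 w hw0
  rw [← hc] at hweak
  have hcross : ∫ p, incr u p * incr w p ∂gagliardoMeasure N s = c⁻¹ * ∫ x, f x * w x := by
    rw [← hweak, ← mul_assoc, inv_mul_cancel₀ hc0.ne', one_mul, integral_gagliardoMeasure]
    rfl
  set E := (gagliardoSq s u).toReal with hE
  set F := (eLpNorm f 2 volume).toReal with hF
  set t := ‖h‖ ^ s with ht
  have ht0 : 0 < t := Real.rpow_pos_of_pos hh0 _
  have hE0 : 0 ≤ E := ENNReal.toReal_nonneg
  have hF0 : 0 ≤ F := ENNReal.toReal_nonneg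
  have hwint : ∫ x, w x ^ 2 ≤ S * t ^ 2 * E := by
    have h1 := integral_shiftDiff_sq_le hs0 hm hu.1.1.2 h
    rw [rpow_two_mul_eq_sq (norm_nonneg h)] at h1
    refine le_trans (integral_mono hwS.1.integrable_sq
      (memLp_shiftDiff hu.1.1.1 h).integrable_sq fun x => ?_) h1
    simp only [hw]
    rw [mul_pow]
    refine mul_le_of_le_one_left (sq_nonneg _) ?_
    exact pow_le_one₀ (hφ.nonneg x) (hφ.le_one x)
  have hfw : |∫ x, f x * w x| ≤ F * (√S * t * √E) := by
    refine (abs_integral_mul_le hf hwm hwS.1).trans ?_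
    gcongr
    refine (Real.sqrt_le_sqrt hwint).trans_eq ?_
    rw [Real.sqrt_mul (by positivity), Real.sqrt_mul hS0.le, Real.sqrt_sq ht0.le]
  have hcr : -(2 * ∫ p, incr u p * incr w p ∂gagliardoMeasure N s)
      ≤ 2 * (c⁻¹ * √S) * t * (F * √E) := by
    rw [hcross]
    have h1 := (neg_le_abs (∫ x, f x * w x)).trans hfw
    have h2 := mul_le_mul_of_nonneg_left h1 (inv_pos.2 hc0).le
    linarith
  have hht : ‖h‖ ≤ ρ ^ (1 - s) * t := by
    calc ‖h‖ = ‖h‖ ^ (1 - s) * ‖h‖ ^ s := by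
          rw [← Real.rpow_add hh0, sub_add_cancel, Real.rpow_one]
      _ ≤ _ := by
          gcongr
  have htρ : t ≤ ρ ^ s := Real.rpow_le_rpow hh0.le hhρ.le hs0.le
  have hmain : ρ⁻¹ * ‖h‖ + 2 * t + (2 + t) * t * κ ≤ C₁ * t := by
    have h1 : ρ⁻¹ * ‖h‖ ≤ ρ⁻¹ * (ρ ^ (1 - s) * t) := by gcongr
    have h2 : (2 + t) * t * κ ≤ (2 + ρ ^ s) * t * κ := by gcongr
    rw [hC₁]
    nlinarith
  have hmainE := mul_le_mul_of_nonneg_right hmain hE0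
  have hfinal : (gagliardoSq s w).toReal ≤ (C₁ + 2 * (c⁻¹ * √S)) * t * dataEnergy s f u := by
    rw [← integral_incr_sq hwm, dataEnergy, ← hE, ← hF]
    have e1 : 0 ≤ C₁ * t * (F * √E) := by positivity
    have e2 : 0 ≤ 2 * (c⁻¹ * √S) * t * E := by positivity
    nlinarith
  exact (ENNReal.le_ofReal_iff_toReal_le hwS.2.ne
    (mul_nonneg (by positivity) (dataEnergy_nonneg f u))).2 hfinal

/-- Adding a long multiple b of the axis n to h gives a vector a = h + b that is still close to the
axis, so a and b both lie in the cone and differ by h. -/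
theorem exists_cone_directions {θ : ℝ} (hθ0 : 0 < θ) (hθ1 : θ < Real.pi / 2) :
    ∃ T : ℝ, 1 < T ∧ ∀ (ρ : ℝ) (n h : Eucl N), ‖n‖ = 1 → h ≠ 0 → T * ‖h‖ < ρ →
      ∃ a b : Eucl N, a ∈ cone ρ θ n ∧ b ∈ cone ρ θ n ∧ a = h + b ∧
        ‖a‖ ≤ T * ‖h‖ ∧ ‖b‖ ≤ T * ‖h‖ := by
  set c := Real.cos θ with hc
  have hc0 : 0 < c := Real.cos_pos_of_mem_Ioo ⟨by linarith [Real.pi_pos], hθ1⟩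
  have hc1 : c < 1 := by
    have := Real.cos_lt_cos_of_nonneg_of_le_pi le_rfl (by linarith [Real.pi_pos]) hθ0
    rwa [Real.cos_zero] at this
  -- The cosine of the angle between h + b and n is at least (t-1)/(t+1). This equals c at
  -- (1+c)/(1-c), and the added 1 makes it strictly larger.
  set t := (1 + c) / (1 - c) + 1 with ht
  have ht1 : 1 < t := by
    have : 0 < (1 + c) / (1 - c) := div_pos (by linarith) (by linarith)
    linarith
  have htc : (t + 1) * c < t - 1 := by
    have h1 : t * (1 - c) = 1 + c + (1 - c) := by
      rw [ht, add_mul, div_mul_cancel₀ _ (by linarith : (1 : ℝ) - c ≠ 0), one_mul]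
    nlinarith
  refine ⟨t + 1, by linarith, fun ρ n h hn hh hρ => ?_⟩
  have hh0 : 0 < ‖h‖ := norm_pos_iff.2 hh
  have hnn : inner ℝ n n = (1 : ℝ) := by rw [real_inner_self_eq_norm_sq, hn, one_pow]
  set b : Eucl N := (t * ‖h‖) • n with hb
  have hbn : ‖b‖ = t * ‖h‖ := by
    rw [hb, norm_smul, hn, mul_one, Real.norm_of_nonneg (by positivity)]
  have hbi : inner ℝ b n = t * ‖h‖ := by rw [hb, real_inner_smul_left, hnn, mul_one]
  have han : ‖h + b‖ ≤ (t + 1) * ‖h‖ := by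
    have := norm_add_le h b
    rw [hbn] at this
    linarith
  have hai : (t - 1) * ‖h‖ ≤ inner ℝ (h + b) n := by
    rw [inner_add_left, hbi]
    have := (abs_le.1 (abs_real_inner_le_norm h n)).1
    rw [hn, mul_one] at this
    linarith
  have hai2 : ‖h + b‖ * c < inner ℝ (h + b) n := by
    calc ‖h + b‖ * c ≤ (t + 1) * ‖h‖ * c := by gcongr
      _ = (t + 1) * c * ‖h‖ := by ring
      _ < (t - 1) * ‖h‖ := by gcongr
      _ ≤ _ := hai
  refine ⟨h + b, b, ⟨?_, han.trans_lt hρ, hai2⟩, ⟨?_, ?_, ?_⟩, rfl, han, ?_⟩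
  · refine norm_pos_iff.2 fun h0 => ?_
    rw [h0, inner_zero_left] at hai
    nlinarith
  · rw [hbn]
    positivity
  · rw [hbn]
    nlinarith
  · rw [hbn, hbi]
    exact mul_lt_of_lt_one_right (by positivity) hc1
  · rw [hbn]
    nlinarith

end Regularity

/-! ### From cone directions to all small shifts -/

section Globalization

variable {N : ℕ} {s : ℝ}

theorem shiftDiff_eq_of_eq_add {u : Eucl N → ℝ} {a b h : Eucl N} (hab : a = h + b) (x : Eucl N) :
    shiftDiff h u x = shiftDiff a u (x - b) - shiftDiff b u (x - b) := by
  simp only [shiftDiff, hab, sub_add_cancel]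
  rw [show x - b + (h + b) = x + h by abel]
  ring

theorem lintegral_incr_sq_comp_shift {w : Eucl N → ℝ} (hw : Measurable w) (b : Eucl N) :
    ∫⁻ p : Eucl N × Eucl N, ENNReal.ofReal (incr w (p.1 - b, p.2 - b) ^ 2)
      ∂gagliardoMeasure N s = gagliardoSq s w := by
  have hi := measurable_incr hw
  rw [gagliardoSq_eq_lintegral hw, ← (measurePreserving_shift (N := N) (s := s)
    (-b)).lintegral_comp (f := fun p => ENNReal.ofReal ((w p.1 - w p.2) ^ 2)) (by fun_prop)]
  simp only [incr, sub_eq_add_neg]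

/-- For a near pair, p.1 is within ρ/4 of a centre, p.2 within another ρ/4, and the shift b adds at
most ρ/2. Both shifted points thus lie in the ball of radius ρ where the cutoff is 1, and one local
term suffices. For a far pair the values themselves are enough, since the kernel is integrable away
from the diagonal. -/
theorem incr_sq_le_sum {u : Eucl N → ℝ} {ρ : ℝ} (hρ : 0 < ρ) {ι : Type*} {Z : Finset ι}
    {c a b : ι → Eucl N} {h : Eucl N} (hab : ∀ z ∈ Z, a z = h + b z)
    (hb : ∀ z ∈ Z, ‖b z‖ ≤ ρ / 2) (p : Eucl N × Eucl N)
    (hp : ‖p.1 - p.2‖ < ρ / 4 → incr (shiftDiff h u) p ≠ 0 → ∃ z ∈ Z, ‖p.1 - c z‖ < ρ / 4) :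
    incr (shiftDiff h u) p ^ 2 ≤
      (∑ z ∈ Z, 2 * (incr (fun x => radialCutoff ρ (c z) x * shiftDiff (a z) u x)
            (p.1 - b z, p.2 - b z) ^ 2 +
          incr (fun x => radialCutoff ρ (c z) x * shiftDiff (b z) u x)
            (p.1 - b z, p.2 - b z) ^ 2)) +
      2 * ((if ρ / 4 ≤ ‖p.1 - p.2‖ then 1 else 0) * shiftDiff h u p.1 ^ 2 +
        (if ρ / 4 ≤ ‖p.1 - p.2‖ then 1 else 0) * shiftDiff h u p.2 ^ 2) := by
  have hsum0 : ∀ z ∈ Z, 0 ≤ 2 * (incr (fun x => radialCutoff ρ (c z) x * shiftDiff (a z) u x)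
            (p.1 - b z, p.2 - b z) ^ 2 +
          incr (fun x => radialCutoff ρ (c z) x * shiftDiff (b z) u x)
            (p.1 - b z, p.2 - b z) ^ 2) := fun z _ => by positivity
  by_cases hfar : ρ / 4 ≤ ‖p.1 - p.2‖
  · simp only [hfar, if_true, one_mul]
    refine le_add_of_nonneg_of_le (Finset.sum_nonneg hsum0) ?_
    rw [incr]
    nlinarith [sq_nonneg (shiftDiff h u p.1 + shiftDiff h u p.2)]
  · simp only [hfar, if_false, zero_mul, add_zero, mul_zero]
    by_cases h0 : incr (shiftDiff h u) p = 0
    · rw [h0, zero_pow two_ne_zero]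
      exact Finset.sum_nonneg hsum0
    obtain ⟨z, hz, hpz⟩ := hp (not_le.1 hfar) h0
    refine le_trans ?_ (Finset.single_le_sum hsum0 hz)
    have h1 : radialCutoff ρ (c z) (p.1 - b z) = 1 := by
      refine radialCutoff_eq_one hρ ?_
      rw [Metric.mem_ball, dist_eq_norm, sub_right_comm]
      linarith [norm_sub_le (p.1 - c z) (b z), hb z hz]
    have h2 : radialCutoff ρ (c z) (p.2 - b z) = 1 := by
      refine radialCutoff_eq_one hρ ?_
      rw [Metric.mem_ball, dist_eq_norm,
        show p.2 - b z - c z = (p.1 - c z) - (p.1 - p.2) - b z by abel]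
      linarith [norm_sub_le ((p.1 - c z) - (p.1 - p.2)) (b z),
        norm_sub_le (p.1 - c z) (p.1 - p.2), hb z hz, not_le.1 hfar]
    simp only [incr, h1, h2, one_mul]
    rw [shiftDiff_eq_of_eq_add (hab z hz) p.1, shiftDiff_eq_of_eq_add (hab z hz) p.2]
    set α := shiftDiff (a z) u (p.1 - b z)
    set α' := shiftDiff (a z) u (p.2 - b z)
    set β := shiftDiff (b z) u (p.1 - b z)
    set β' := shiftDiff (b z) u (p.2 - b z)
    nlinarith [sq_nonneg (α - α' + (β - β'))]

theorem gagliardoSq_shiftDiff_le_sum {u : Eucl N → ℝ} (hm : Measurable u) {ρ : ℝ} (hρ : 0 < ρ)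
    {ι : Type*} {Z : Finset ι} {c a b : ι → Eucl N} {h : Eucl N}
    (hab : ∀ z ∈ Z, a z = h + b z) (hb : ∀ z ∈ Z, ‖b z‖ ≤ ρ / 2)
    (hp : ∀ p : Eucl N × Eucl N, ‖p.1 - p.2‖ < ρ / 4 → incr (shiftDiff h u) p ≠ 0 →
      ∃ z ∈ Z, ‖p.1 - c z‖ < ρ / 4) :
    gagliardoSq s (shiftDiff h u) ≤
      (∑ z ∈ Z, 2 * (gagliardoSq s (fun x => radialCutoff ρ (c z) x * shiftDiff (a z) u x) +
        gagliardoSq s (fun x => radialCutoff ρ (c z) x * shiftDiff (b z) u x))) +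
      4 * (ENNReal.ofReal (1 + (4 / ρ) ^ 2) * kernelMoment N s *
        ∫⁻ y, ENNReal.ofReal (shiftDiff h u y ^ 2)) := by
  have hw : ∀ (z : ι) (v : Eucl N),
      Measurable fun x => radialCutoff ρ (c z) x * shiftDiff v u x := fun z v =>
    (isCutoff_radialCutoff hρ (c z)).measurable.mul (measurable_shiftDiff hm v)
  have hi : ∀ (z : ι) (v : Eucl N), Measurable fun p : Eucl N × Eucl N =>
      ENNReal.ofReal (incr (fun x => radialCutoff ρ (c z) x * shiftDiff v u x)
        (p.1 - b z, p.2 - b z) ^ 2) := fun z v => by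
    have := measurable_incr (hw z v)
    fun_prop
  have hi2 : ∀ z : ι, Measurable fun p : Eucl N × Eucl N =>
      2 * (ENNReal.ofReal (incr (fun x => radialCutoff ρ (c z) x * shiftDiff (a z) u x)
        (p.1 - b z, p.2 - b z) ^ 2) +
      ENNReal.ofReal (incr (fun x => radialCutoff ρ (c z) x * shiftDiff (b z) u x)
        (p.1 - b z, p.2 - b z) ^ 2)) := fun z => ((hi z (a z)).add (hi z (b z))).const_mul 2
  have hDm := measurable_shiftDiff hm h
  set W : Eucl N × Eucl N → ℝ := fun p => if ρ / 4 ≤ ‖p.1 - p.2‖ then 1 else 0 with hW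
  have hW0 : ∀ p, 0 ≤ W p := fun p => by
    simp only [hW]
    split_ifs <;> norm_num
  have hWm : Measurable W :=
    Measurable.ite (measurableSet_le measurable_const (by fun_prop)) measurable_const
      measurable_const
  have hWle : ∀ p, W p ≤ (1 + (4 / ρ) ^ 2) * min 1 (‖p.1 - p.2‖ ^ 2) := by
    intro p
    simp only [hW]
    split_ifs with hfar
    · have h1 : 1 ≤ (4 / ρ) ^ 2 * ‖p.1 - p.2‖ ^ 2 := by
        rw [← mul_pow]
        refine one_le_pow₀ ?_
        rw [div_mul_eq_mul_div, le_div_iff₀ hρ]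
        linarith
      rcases min_cases 1 (‖p.1 - p.2‖ ^ 2) with ⟨h, _⟩ | ⟨h, _⟩ <;> rw [h]
      · nlinarith [sq_nonneg (4 / ρ)]
      · nlinarith [sq_nonneg ‖p.1 - p.2‖]
    · positivity
  have hk1 := lintegral_weight_mul_sq_fst_le (s := s) hWm hDm
    (by positivity : 0 ≤ 1 + (4 / ρ) ^ 2) hWle
  have hk2 := lintegral_weight_mul_sq_snd_le (s := s) hWm hDm
    (by positivity : 0 ≤ 1 + (4 / ρ) ^ 2) hWle
  calc gagliardoSq s (shiftDiff h u)
      = ∫⁻ p, ENNReal.ofReal (incr (shiftDiff h u) p ^ 2) ∂gagliardoMeasure N s :=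
        gagliardoSq_eq_lintegral hDm
    _ ≤ ∫⁻ p : Eucl N × Eucl N, ((∑ z ∈ Z,
          2 * (ENNReal.ofReal (incr (fun x => radialCutoff ρ (c z) x * shiftDiff (a z) u x)
            (p.1 - b z, p.2 - b z) ^ 2) +
          ENNReal.ofReal (incr (fun x => radialCutoff ρ (c z) x * shiftDiff (b z) u x)
            (p.1 - b z, p.2 - b z) ^ 2))) +
          2 * (ENNReal.ofReal (W p * shiftDiff h u p.1 ^ 2) +
            ENNReal.ofReal (W p * shiftDiff h u p.2 ^ 2))) ∂gagliardoMeasure N s := by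
        refine lintegral_mono fun p => ?_
        refine (ENNReal.ofReal_le_ofReal (incr_sq_le_sum hρ hab hb p (hp p))).trans_eq ?_
        have h2 : ENNReal.ofReal 2 = 2 := by simp
        rw [ENNReal.ofReal_add (Finset.sum_nonneg fun z _ => by positivity)
          (mul_nonneg two_pos.le (add_nonneg (mul_nonneg (hW0 p) (sq_nonneg _))
            (mul_nonneg (hW0 p) (sq_nonneg _)))),
          ENNReal.ofReal_sum_of_nonneg fun z _ => by positivity, ENNReal.ofReal_mul two_pos.le,
          ENNReal.ofReal_add (mul_nonneg (hW0 p) (sq_nonneg _))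
            (mul_nonneg (hW0 p) (sq_nonneg _)), h2]
        congr 1
        refine Finset.sum_congr rfl fun z _ => ?_
        rw [ENNReal.ofReal_mul two_pos.le, ENNReal.ofReal_add (sq_nonneg _) (sq_nonneg _), h2]
    _ = (∑ z ∈ Z, 2 * (gagliardoSq s (fun x => radialCutoff ρ (c z) x * shiftDiff (a z) u x) +
          gagliardoSq s (fun x => radialCutoff ρ (c z) x * shiftDiff (b z) u x))) +
        2 * (∫⁻ p, ENNReal.ofReal (W p * shiftDiff h u p.1 ^ 2) ∂gagliardoMeasure N s +
          ∫⁻ p, ENNReal.ofReal (W p * shiftDiff h u p.2 ^ 2) ∂gagliardoMeasure N s) := by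
        rw [lintegral_add_right _ (by fun_prop), lintegral_const_mul _ (by fun_prop),
          lintegral_add_right _ (by fun_prop), lintegral_finsetSum _ (fun z _ => hi2 z)]
        congr 1
        refine Finset.sum_congr rfl fun z _ => ?_
        rw [lintegral_const_mul' _ _ ENNReal.ofNat_ne_top,
          lintegral_add_right _ (hi z (b z)), lintegral_incr_sq_comp_shift (hw z _),
          lintegral_incr_sq_comp_shift (hw z _)]
    _ ≤ _ := by
        refine add_le_add le_rfl ?_
        refine (mul_le_mul_right (add_le_add hk1 hk2) 2).trans_eq ?_
        ring

theorem exists_gagliardoSq_shiftDiff_le (N : ℕ) [NeZero N] {s ρ θ : ℝ} (d : ℝ) (hs0 : 0 < s)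
    (hs1 : s < 1) (hρ : 0 < ρ) (hθ0 : 0 < θ) (hθ1 : θ < Real.pi / 2) :
    ∃ C h₀ : ℝ, 0 ≤ C ∧ 0 < h₀ ∧ ∀ (Ω : Set (Eucl N)) (f u : Eucl N → ℝ) (x₁ : Eucl N),
      LipschitzCone ρ θ Ω → Ω ⊆ Metric.closedBall x₁ d →
      MemLp f 2 volume → Measurable u → (∀ x, x ∉ Ω → u x = 0) → IsWeakSolution s Ω f u →
      ∀ h : Eucl N, ‖h‖ ≤ h₀ →
        gagliardoSq s (shiftDiff h u) ≤ ENNReal.ofReal (C * ‖h‖ ^ s * dataEnergy s f u) := by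
  obtain ⟨C₁, hC₁, hloc⟩ := exists_gagliardoSq_localized_le N hs0 hs1 hρ
  obtain ⟨T, hT1, hdir⟩ := exists_cone_directions hθ0 hθ1
  -- A fixed ball about the origin is covered, and the centres are later translated by x₁, so their
  -- number depends only on N, d and ρ.
  obtain ⟨Z, -, hZfin, hZ⟩ := (isCompact_closedBall (0 : Eucl N) (d + ρ)).finite_cover_balls
    (by positivity : 0 < ρ / 4)
  lift Z to Finset (Eucl N) using hZfin
  set S := shiftConst N s with hS
  have hS0 : 0 < S := shiftConst_pos
  set κ := (1 + (4 / ρ) ^ 2) * (kernelMoment N s).toReal with hκ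
  have hκ0 : 0 ≤ κ := by positivity
  have hT0 : 0 < T := by linarith
  -- Makes T‖h‖ ≤ ρ/4, so the cone vectors are shorter than ρ and the shifts below ρ/2.
  set h₀ := ρ / (4 * T) with hh₀
  have hh₀0 : 0 < h₀ := by positivity
  refine ⟨Z.card * (4 * (C₁ * T ^ s)) + 4 * (κ * (S * h₀ ^ s)), h₀, by positivity, hh₀0, ?_⟩
  intro Ω f u x₁ hΩ hΩd hf hm hu0 hu h hh
  rcases eq_or_ne h 0 with rfl | hne
  · have : shiftDiff (0 : Eucl N) u = fun _ => 0 := by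
      funext x
      simp [shiftDiff]
    rw [this]
    simp [gagliardoSq]
  have hhT : T * ‖h‖ ≤ ρ / 4 := by
    calc T * ‖h‖ ≤ T * h₀ := by gcongr
      _ = ρ / 4 := by
        rw [hh₀]
        field_simp
  have hhρ : ‖h‖ ≤ ρ / 4 := by nlinarith [norm_nonneg h]
  choose n hn using fun z : Eucl N => hΩ (x₁ + z)
  choose a b ha hb hab hal hbl using fun z : Eucl N =>
    hdir ρ (n z) h (hn z).1 hne (by linarith)
  set M := dataEnergy s f u with hM
  have hM0 : 0 ≤ M := dataEnergy_nonneg f u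
  have hsum := gagliardoSq_shiftDiff_le_sum (s := s) hm hρ (Z := Z) (c := fun z => x₁ + z)
    (a := a) (b := b) (h := h) (fun z _ => hab z) (fun z _ => by linarith [hbl z]) ?_
  · refine hsum.trans ?_
    have hterm : ∀ z v : Eucl N, v ∈ cone ρ θ (n z) → ‖v‖ ≤ T * ‖h‖ →
        gagliardoSq s (fun x => radialCutoff ρ (x₁ + z) x * shiftDiff v u x) ≤
          ENNReal.ofReal (C₁ * T ^ s * ‖h‖ ^ s * M) := by
      intro z v hv hvl
      refine (hloc θ Ω f u hf hm hu0 hu _ _ (hn z) v hv).trans (ENNReal.ofReal_le_ofReal ?_)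
      have : ‖v‖ ^ s ≤ T ^ s * ‖h‖ ^ s := by
        rw [← Real.mul_rpow hT0.le (norm_nonneg h)]
        exact Real.rpow_le_rpow (norm_nonneg v) hvl hs0.le
      rw [mul_assoc C₁ (T ^ s)]
      gcongr
    have hE := hu.1.1.2
    have hD : ∫⁻ y, ENNReal.ofReal (shiftDiff h u y ^ 2) ≤
        ENNReal.ofReal (S * h₀ ^ s * ‖h‖ ^ s * M) := by
      refine (lintegral_shiftDiff_sq_le hs0 hm h).trans ?_
      rw [← ENNReal.ofReal_toReal hE.ne, ← ENNReal.ofReal_mul (by positivity)]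
      refine ENNReal.ofReal_le_ofReal ?_
      rw [rpow_two_mul_eq_sq (norm_nonneg h)]
      have h1 : (gagliardoSq s u).toReal ≤ M := by
        rw [hM, dataEnergy]
        exact le_add_of_nonneg_right (by positivity)
      have h2 : ‖h‖ ^ s ≤ h₀ ^ s := Real.rpow_le_rpow (norm_nonneg h) hh hs0.le
      have h3 : 0 ≤ ‖h‖ ^ s := by positivity
      calc S * (‖h‖ ^ s) ^ 2 * (gagliardoSq s u).toReal
          = S * ‖h‖ ^ s * ‖h‖ ^ s * (gagliardoSq s u).toReal := by ring
        _ ≤ S * h₀ ^ s * ‖h‖ ^ s * M := by gcongr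
    have hκe : ENNReal.ofReal (1 + (4 / ρ) ^ 2) * kernelMoment N s = ENNReal.ofReal κ := by
      rw [hκ, ENNReal.ofReal_mul (by positivity),
        ENNReal.ofReal_toReal (kernelMoment_lt_top hs0 hs1).ne]
    have h2 : ∀ X : ℝ, 0 ≤ X → 2 * (ENNReal.ofReal X + ENNReal.ofReal X)
        = ENNReal.ofReal (4 * X) := by
      intro X hX
      rw [← ENNReal.ofReal_add hX hX, show 4 * X = 2 * (X + X) by ring,
        ENNReal.ofReal_mul two_pos.le]
      simp
    have h4 : ∀ X : ℝ, 4 * ENNReal.ofReal X = ENNReal.ofReal (4 * X) := by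
      intro X
      rw [ENNReal.ofReal_mul four_pos.le]
      simp
    have hcard : (Z.card : ℝ≥0∞) = ENNReal.ofReal Z.card := by simp
    calc _ ≤ (∑ _z ∈ Z, 2 * (ENNReal.ofReal (C₁ * T ^ s * ‖h‖ ^ s * M) +
            ENNReal.ofReal (C₁ * T ^ s * ‖h‖ ^ s * M))) +
          4 * (ENNReal.ofReal κ * ENNReal.ofReal (S * h₀ ^ s * ‖h‖ ^ s * M)) := by
          rw [hκe]
          gcongr with z hz
          · exact hterm z _ (ha z) (hal z)
          · exact hterm z _ (hb z) (hbl z)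
      _ = _ := by
          rw [Finset.sum_const, nsmul_eq_mul, hcard, h2 _ (by positivity),
            ← ENNReal.ofReal_mul (by positivity), ← ENNReal.ofReal_mul (by positivity), h4,
            ← ENNReal.ofReal_add (by positivity) (by positivity)]
          congr 1
          ring
  · intro p hpl hp0
    -- Otherwise p.1 is farther than ρ from Ω, and all four values of u in the increment of the
    -- difference vanish.
    have hmem : p.1 - x₁ ∈ Metric.closedBall (0 : Eucl N) (d + ρ) := by
      rw [mem_closedBall_zero_iff]
      by_contra hlt
      refine hp0 ?_
      have hz : ∀ y : Eucl N, ‖p.1 - y‖ < ρ → u y = 0 := by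
        intro y hy
        refine hu0 y fun hyΩ => hlt ?_
        have h1 := hΩd hyΩ
        rw [Metric.mem_closedBall, dist_eq_norm] at h1
        rw [show p.1 - x₁ = (p.1 - y) + (y - x₁) by abel]
        linarith [norm_add_le (p.1 - y) (y - x₁)]
      have z1 := hz p.1 (by simpa using hρ)
      have z2 := hz (p.1 + h) (by
        rw [sub_add_cancel_left, norm_neg]
        linarith)
      have z3 := hz p.2 (by linarith)
      have z4 := hz (p.2 + h) (by
        rw [← sub_sub]
        linarith [norm_sub_le (p.1 - p.2) h])
      simp [incr, shiftDiff, z1, z2, z3, z4]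
    have hcov := hZ hmem
    simp only [mem_iUnion, Metric.mem_ball, dist_eq_norm] at hcov
    obtain ⟨z, hz, hlt⟩ := hcov
    refine ⟨z, hz, ?_⟩
    rwa [← sub_sub]

end Globalization

/-! ### From second differences to the Besov norm -/

section Besov

variable {N : ℕ}

theorem eLpNorm_comp_add_right {v : Eucl N → ℝ} (hv : MemLp v 2 volume) (h : Eucl N) :
    eLpNorm (fun x => v (x + h)) 2 volume = eLpNorm v 2 volume :=
  eLpNorm_comp_measurePreserving hv.1 (measurePreserving_add_right volume h)

theorem eLpNorm_shiftDiff_le {v : Eucl N → ℝ} (hv : MemLp v 2 volume) (h : Eucl N) :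
    eLpNorm (shiftDiff h v) 2 volume ≤ 2 * eLpNorm v 2 volume := by
  have hvh : MemLp (fun x => v (x + h)) 2 volume :=
    hv.comp_measurePreserving (measurePreserving_add_right volume h)
  refine (eLpNorm_sub_le hvh.1 hv.1 one_le_two).trans_eq ?_
  rw [eLpNorm_comp_add_right hv, two_mul]

theorem shiftDiff_comm (h k : Eucl N) (v : Eucl N → ℝ) :
    shiftDiff k (shiftDiff h v) = shiftDiff h (shiftDiff k v) := by
  funext x
  simp only [shiftDiff]
  rw [add_right_comm x k h]
  ring

theorem shiftDiff_add (h : Eucl N) (v w : Eucl N → ℝ) :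
    shiftDiff h (v + w) = shiftDiff h v + shiftDiff h w := by
  funext x
  simp only [shiftDiff, Pi.add_apply]
  ring

theorem shiftDiff_smul (h : Eucl N) (c : ℝ) (v : Eucl N → ℝ) :
    shiftDiff h (c • v) = c • shiftDiff h v := by
  funext x
  simp only [shiftDiff, Pi.smul_apply, smul_eq_mul]
  ring

theorem second_difference_eq (h : Eucl N) (u : Eucl N → ℝ) :
    (fun x => u (x + (2 : ℝ) • h) - 2 * u (x + h) + u x) = shiftDiff h (shiftDiff h u) := by
  funext x
  simp only [shiftDiff]
  rw [two_smul, add_assoc]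
  ring

theorem eLpNorm_shiftDiff_shiftDiff_le {v : Eucl N → ℝ} (hv : MemLp v 2 volume) (h : Eucl N) :
    eLpNorm (shiftDiff h (shiftDiff h v)) 2 volume ≤ 4 * eLpNorm v 2 volume := by
  refine (eLpNorm_shiftDiff_le (memLp_shiftDiff hv h) h).trans ?_
  refine (mul_le_mul_right (eLpNorm_shiftDiff_le hv h) 2).trans_eq ?_
  rw [← mul_assoc]
  norm_num

theorem secondDiffSeminorm_le {r : ℝ} {u : Eucl N → ℝ} {Q : ℝ}
    (H : ∀ h : Eucl N, h ≠ 0 →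
      eLpNorm (shiftDiff h (shiftDiff h u)) 2 volume ≤ ENNReal.ofReal (Q * ‖h‖ ^ r)) :
    secondDiffSeminorm r u ≤ ENNReal.ofReal Q := by
  refine iSup₂_le fun h hh => ?_
  have hp : 0 < ‖h‖ ^ r := Real.rpow_pos_of_pos (norm_pos_iff.2 hh) _
  rw [second_difference_eq]
  refine ENNReal.div_le_of_le_mul ?_
  rw [← ENNReal.ofReal_mul' hp.le]
  exact H h hh

/-- The dyadic difference quotient `2^k (u(· + 2^{-k} e) - u)`. -/
noncomputable def dyadicQuotient (e : Eucl N) (u : Eucl N → ℝ) (k : ℕ) : Eucl N → ℝ :=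
  (2 : ℝ) ^ k • shiftDiff (((1 : ℝ) / 2) ^ k • e) u

theorem memLp_dyadicQuotient {u : Eucl N → ℝ} (hu : MemLp u 2 volume) (e : Eucl N) (k : ℕ) :
    MemLp (dyadicQuotient e u k) 2 volume :=
  (memLp_shiftDiff hu _).const_smul _

theorem dyadicQuotient_sub_succ (e : Eucl N) (u : Eucl N → ℝ) (k : ℕ) :
    dyadicQuotient e u k - dyadicQuotient e u (k + 1) = (2 : ℝ) ^ k •
      shiftDiff (((1 : ℝ) / 2) ^ (k + 1) • e) (shiftDiff (((1 : ℝ) / 2) ^ (k + 1) • e) u) := by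
  funext x
  have h2 : ((1 : ℝ) / 2) ^ k • e = ((1 : ℝ) / 2) ^ (k + 1) • e + ((1 : ℝ) / 2) ^ (k + 1) • e := by
    rw [← add_smul]
    congr 1
    ring
  simp only [dyadicQuotient, Pi.sub_apply, Pi.smul_apply, shiftDiff, smul_eq_mul]
  rw [h2, add_assoc]
  ring

/-- Consecutive dyadic quotients differ by 2^k times a second difference of step 2^(-k-1), hence by
at most Q 2^(k(1-r)) in L². Since r > 1 this is a geometric series. -/
theorem exists_limit_dyadicQuotient {r Q : ℝ} (hr1 : 1 < r) (hQ : 0 ≤ Q) {u : Eucl N → ℝ}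
    (hu : MemLp u 2 volume)
    (H : ∀ h : Eucl N, h ≠ 0 →
      eLpNorm (shiftDiff h (shiftDiff h u)) 2 volume ≤ ENNReal.ofReal (Q * ‖h‖ ^ r))
    {e : Eucl N} (he : ‖e‖ = 1) :
    ∃ g : Eucl N → ℝ, MemLp g 2 volume ∧ ∀ k : ℕ, eLpNorm (dyadicQuotient e u k - g) 2 volume
      ≤ ENNReal.ofReal (Q * ((2 : ℝ) ^ (1 - r)) ^ k / (1 - (2 : ℝ) ^ (1 - r))) := by
  set β : ℝ := (2 : ℝ) ^ (1 - r) with hβ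
  have hβ0 : 0 < β := by positivity
  have hβ1 : β < 1 := Real.rpow_lt_one_of_one_lt_of_neg one_lt_two (by linarith)
  have he0 : e ≠ 0 := norm_ne_zero_iff.1 (by rw [he]; exact one_ne_zero)
  have hq := memLp_dyadicQuotient hu e
  set F : ℕ → Lp ℝ 2 (volume : Measure (Eucl N)) := fun k => (hq k).toLp with hF
  have hdist : ∀ k, dist (F k) (F (k + 1)) ≤ Q * β ^ k := by
    intro k
    rw [hF, Lp.dist_def]
    refine ENNReal.toReal_le_of_le_ofReal (by positivity) ?_
    rw [eLpNorm_congr_ae ((hq k).coeFn_toLp.sub (hq (k + 1)).coeFn_toLp),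
      dyadicQuotient_sub_succ, eLpNorm_const_smul, Real.enorm_of_nonneg (by positivity)]
    refine (mul_le_mul_right (H _ (smul_ne_zero (by positivity) he0)) _).trans ?_
    rw [← ENNReal.ofReal_mul (by positivity)]
    refine ENNReal.ofReal_le_ofReal ?_
    rw [norm_smul, he, mul_one, Real.norm_of_nonneg (by positivity)]
    have h1 : (((1 : ℝ) / 2) ^ (k + 1)) ^ r ≤ (1 / 2) ^ k * β ^ k := by
      have e1 : (((1 : ℝ) / 2) ^ k) ^ r = (1 / 2) ^ k * β ^ k := by
        rw [← mul_pow, hβ, ← Real.rpow_natCast, ← Real.rpow_natCast, ← Real.rpow_mul (by norm_num),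
          mul_comm (k : ℝ), Real.rpow_mul (by norm_num)]
        congr 1
        rw [one_div, Real.inv_rpow two_pos.le, Real.rpow_sub two_pos, Real.rpow_one]
        field_simp
      rw [← e1]
      refine Real.rpow_le_rpow (by positivity) ?_ (by linarith)
      exact pow_le_pow_of_le_one (by norm_num) (by norm_num) (Nat.le_succ k)
    calc (2 : ℝ) ^ k * (Q * (((1 : ℝ) / 2) ^ (k + 1)) ^ r)
        ≤ (2 : ℝ) ^ k * (Q * ((1 / 2) ^ k * β ^ k)) := by gcongr
      _ = Q * β ^ k * (2 * (1 / 2)) ^ k := by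
        rw [mul_pow]
        ring
      _ = Q * β ^ k := by norm_num
  obtain ⟨G, hG⟩ := cauchySeq_tendsto_of_complete (cauchySeq_of_le_geometric β Q hβ1 hdist)
  refine ⟨G, Lp.memLp G, fun k => ?_⟩
  have h1 := dist_le_of_le_geometric_of_tendsto β Q hβ1 hdist hG k
  rw [hF, Lp.dist_def, eLpNorm_congr_ae ((hq k).coeFn_toLp.sub (ae_eq_refl _))] at h1
  exact (ENNReal.le_ofReal_iff_toReal_le ((hq k).sub (Lp.memLp G)).2.ne
    (div_nonneg (by positivity) (by linarith))).2 h1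

theorem integrable_mul_of_memLp {f g : Eucl N → ℝ} (hf : MemLp f 2 volume)
    (hg : MemLp g 2 volume) : Integrable (fun x => f x * g x) volume :=
  hf.integrable_mul hg

theorem tendsto_integral_mul_of_eLpNorm_sub {g φ : Eucl N → ℝ} {q : ℕ → Eucl N → ℝ}
    (hg : MemLp g 2 volume) (hq : ∀ k, MemLp (q k) 2 volume) (hφ : MemLp φ 2 volume)
    (h : Tendsto (fun k => eLpNorm (q k - g) 2 volume) atTop (𝓝 0)) :
    Tendsto (fun k => ∫ x, q k x * φ x) atTop (𝓝 (∫ x, g x * φ x)) := by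
  rw [tendsto_iff_edist_tendsto_0]
  have h2 := ENNReal.Tendsto.mul_const (b := eLpNorm φ 2 volume) h (Or.inr hφ.2.ne)
  rw [zero_mul] at h2
  refine tendsto_of_tendsto_of_tendsto_of_le_of_le tendsto_const_nhds h2
    (fun _ => zero_le) fun k => ?_
  rw [edist_eq_enorm_sub, ← integral_sub (integrable_mul_of_memLp (hq k) hφ)
    (integrable_mul_of_memLp hg hφ)]
  have := enorm_integral_mul_le ((hq k).sub hg) hφ
  simp only [Pi.sub_apply, sub_mul] at this
  exact this

theorem integral_shiftDiff_mul {u φ : Eucl N → ℝ} (hu : MemLp u 2 volume)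
    (hφ : MemLp φ 2 volume) (h : Eucl N) :
    ∫ x, shiftDiff h u x * φ x = ∫ x, (φ (x + -h) - φ x) * u x := by
  have huh : MemLp (fun x => u (x + h)) 2 volume :=
    hu.comp_measurePreserving (measurePreserving_add_right volume h)
  have hφh : MemLp (fun x => φ (x + -h)) 2 volume :=
    hφ.comp_measurePreserving (measurePreserving_add_right volume (-h))
  simp only [shiftDiff, sub_mul]
  rw [integral_sub (integrable_mul_of_memLp huh hφ) (integrable_mul_of_memLp hu hφ),
    integral_sub (integrable_mul_of_memLp hφh hu) (integrable_mul_of_memLp hφ hu),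
    ← integral_add_right_eq_self (fun x => φ (x + -h) * u x) h]
  simp only [add_neg_cancel_right, mul_comm]

/-- Discrete integration by parts moves the quotient onto the test function, in direction -e, which
accounts for the sign. The limit there is taken against u ∈ L¹. -/
theorem isWeakPartial_of_tendsto {u g : Eucl N → ℝ} (hu : MemLp u 2 volume)
    (hu1 : Integrable u volume) (hg : MemLp g 2 volume) (i : Fin N)
    (h : Tendsto (fun k => eLpNorm
      (dyadicQuotient (EuclideanSpace.single i 1) u k - g) 2 volume) atTop (𝓝 0)) :
    IsWeakPartial i u g := by
  refine ⟨hu.locallyIntegrable one_le_two, hg.locallyIntegrable one_le_two, fun φ hφ hφc => ?_⟩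
  set e : Eucl N := EuclideanSpace.single i 1 with he
  have hφ2 : MemLp φ 2 volume := hφ.continuous.memLp_of_hasCompactSupport hφc
  obtain ⟨L, hL⟩ := hφ.lipschitzWith_of_hasCompactSupport hφc (by simp)
  have h1 := tendsto_integral_mul_of_eLpNorm_sub hg (memLp_dyadicQuotient hu e) hφ2 h
  have h2 := hL.integral_inv_smul_sub_mul_tendsto_integral_lineDeriv_mul hu1 (-e)
  have hpow : Tendsto (fun k : ℕ => ((1 : ℝ) / 2) ^ k) atTop (𝓝[>] 0) := by
    refine tendsto_nhdsWithin_iff.2 ⟨tendsto_pow_atTop_nhds_zero_of_lt_one (by norm_num)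
      (by norm_num), Eventually.of_forall fun k => ?_⟩
    have : (0 : ℝ) < (1 / 2) ^ k := by positivity
    exact this
  have h3 := h2.comp hpow
  have heq : ∀ k : ℕ, ∫ x, dyadicQuotient e u k x * φ x
      = ∫ x, ((((1 : ℝ) / 2) ^ k)⁻¹ • (φ (x + ((1 : ℝ) / 2) ^ k • -e) - φ x)) * u x := by
    intro k
    simp only [dyadicQuotient, Pi.smul_apply, smul_eq_mul, mul_assoc, integral_const_mul]
    rw [integral_shiftDiff_mul hu hφ2, one_div, inv_pow, inv_inv, smul_neg]
  have h4 := tendsto_nhds_unique (h1.congr heq) h3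
  rw [h4, ← integral_neg]
  refine integral_congr_ae (Eventually.of_forall fun x => ?_)
  have hd : DifferentiableAt ℝ φ x := (hφ.differentiable (by simp)) x
  simp only
  rw [hd.lineDeriv_eq_fderiv, map_neg]
  ring

/-- For |h| < 1 choose k with 2^(-k-1) < |h| ≤ 2^(-k) and split g as q_k - (q_k - g), q_k being the
dyadic quotient. Differences commute, so that of q_k is 2^k times a first difference of D_h D_h u,
at most 2^(k+1) Q |h|^r; the remainder is O(2^(k(1-r))). Both are O(|h|^(r-1)). -/
theorem eLpNorm_second_difference_limit_le {r Q : ℝ} (hr1 : 1 < r) (hr2 : r < 2) (hQ : 0 ≤ Q)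
    {u g : Eucl N → ℝ} (hu : MemLp u 2 volume) (hg : MemLp g 2 volume)
    (H : ∀ h : Eucl N, h ≠ 0 →
      eLpNorm (shiftDiff h (shiftDiff h u)) 2 volume ≤ ENNReal.ofReal (Q * ‖h‖ ^ r))
    {e : Eucl N} {K : ℝ} (hK : 0 ≤ K)
    (hgK : eLpNorm g 2 volume ≤ ENNReal.ofReal ((2 + K) * Q))
    (hqg : ∀ k : ℕ, eLpNorm (dyadicQuotient e u k - g) 2 volume
      ≤ ENNReal.ofReal (K * Q * ((2 : ℝ) ^ (1 - r)) ^ k)) (h : Eucl N) (hh : h ≠ 0) :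
    eLpNorm (shiftDiff h (shiftDiff h g)) 2 volume
      ≤ ENNReal.ofReal (8 * (1 + K) * Q * ‖h‖ ^ (r - 1)) := by
  have hh0 : 0 < ‖h‖ := norm_pos_iff.2 hh
  have h4 : ∀ X : ℝ, 4 * ENNReal.ofReal X = ENNReal.ofReal (4 * X) := by
    intro X
    rw [ENNReal.ofReal_mul four_pos.le]
    simp
  rcases le_or_gt 1 ‖h‖ with h1 | h1
  · refine (eLpNorm_shiftDiff_shiftDiff_le hg h).trans ?_
    refine (mul_le_mul_right hgK 4).trans ?_
    rw [h4]
    refine ENNReal.ofReal_le_ofReal ?_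
    have : 1 ≤ ‖h‖ ^ (r - 1) := Real.one_le_rpow h1 (by linarith)
    have hx : 0 ≤ 8 * (1 + K) * Q := by positivity
    nlinarith [mul_nonneg hK hQ]
  obtain ⟨k, hk1, hk2⟩ := exists_nat_pow_near_of_lt_one hh0 h1.le (by norm_num : (0 : ℝ) < 1 / 2)
    (by norm_num)
  have hq := memLp_dyadicQuotient hu e k
  have hdec : shiftDiff h (shiftDiff h g) =
      shiftDiff h (shiftDiff h (dyadicQuotient e u k)) -
        shiftDiff h (shiftDiff h (dyadicQuotient e u k - g)) := by
    have : dyadicQuotient e u k = (dyadicQuotient e u k - g) + g := by rw [sub_add_cancel]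
    conv_rhs => rw [this]
    rw [shiftDiff_add, shiftDiff_add, sub_add_cancel, add_sub_cancel_left]
  have hqu : eLpNorm (shiftDiff h (shiftDiff h (dyadicQuotient e u k))) 2 volume
      ≤ ENNReal.ofReal (2 * Q * ‖h‖ ^ (r - 1)) := by
    rw [dyadicQuotient, shiftDiff_smul, shiftDiff_smul, shiftDiff_comm _ h u,
      shiftDiff_comm _ h (shiftDiff h u), eLpNorm_const_smul, Real.enorm_of_nonneg (by positivity)]
    calc _ ≤ ENNReal.ofReal (2 ^ k) * (2 * ENNReal.ofReal (Q * ‖h‖ ^ r)) := by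
          gcongr
          refine (eLpNorm_shiftDiff_le (memLp_shiftDiff (memLp_shiftDiff hu h) h) _).trans ?_
          exact mul_le_mul_right (H h hh) 2
      _ = ENNReal.ofReal (2 * Q * (2 ^ k * ‖h‖ * ‖h‖ ^ (r - 1))) := by
          have h2 : ∀ X : ℝ, 2 * ENNReal.ofReal X = ENNReal.ofReal (2 * X) := by
            intro X
            rw [ENNReal.ofReal_mul two_pos.le]
            simp
          rw [h2, ← ENNReal.ofReal_mul (by positivity)]
          congr 1
          rw [show ‖h‖ ^ r = ‖h‖ * ‖h‖ ^ (r - 1) by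
            rw [Real.rpow_sub hh0, Real.rpow_one, mul_div_cancel₀ _ hh0.ne']]
          ring
      _ ≤ _ := by
          refine ENNReal.ofReal_le_ofReal ?_
          have h2 : 2 ^ k * ‖h‖ ≤ 1 := by
            calc (2 : ℝ) ^ k * ‖h‖ ≤ 2 ^ k * (1 / 2) ^ k := by gcongr
              _ = 1 := by
                rw [← mul_pow]
                norm_num
          have h3 : 0 ≤ ‖h‖ ^ (r - 1) := by positivity
          have h5 := mul_le_mul_of_nonneg_right h2 h3
          rw [one_mul] at h5
          exact mul_le_mul_of_nonneg_left h5 (by positivity)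
  have hqd : eLpNorm (shiftDiff h (shiftDiff h (dyadicQuotient e u k - g))) 2 volume
      ≤ ENNReal.ofReal (8 * K * Q * ‖h‖ ^ (r - 1)) := by
    refine (eLpNorm_shiftDiff_shiftDiff_le (hq.sub hg) h).trans ?_
    refine (mul_le_mul_right (hqg k) 4).trans ?_
    rw [h4]
    refine ENNReal.ofReal_le_ofReal ?_
    have hβ : ((2 : ℝ) ^ (1 - r)) ^ k = (((1 : ℝ) / 2) ^ k) ^ (r - 1) := by
      rw [← Real.rpow_natCast, ← Real.rpow_natCast, ← Real.rpow_mul two_pos.le,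
        ← Real.rpow_mul (by norm_num), one_div, Real.inv_rpow two_pos.le, ← Real.rpow_neg two_pos.le]
      congr 1
      ring
    have h2 : ((2 : ℝ) ^ (1 - r)) ^ k ≤ 2 * ‖h‖ ^ (r - 1) := by
      rw [hβ]
      calc (((1 : ℝ) / 2) ^ k) ^ (r - 1) ≤ (2 * ‖h‖) ^ (r - 1) := by
            refine Real.rpow_le_rpow (by positivity) ?_ (by linarith)
            rw [pow_succ] at hk1
            linarith
        _ = 2 ^ (r - 1) * ‖h‖ ^ (r - 1) := Real.mul_rpow two_pos.le hh0.le
        _ ≤ 2 * ‖h‖ ^ (r - 1) := by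
            gcongr
            calc (2 : ℝ) ^ (r - 1) ≤ 2 ^ (1 : ℝ) :=
                  Real.rpow_le_rpow_of_exponent_le one_le_two (by linarith)
              _ = 2 := Real.rpow_one 2
    have h3 := mul_le_mul_of_nonneg_left h2 (mul_nonneg hK hQ)
    linarith
  rw [hdec]
  refine (eLpNorm_sub_le (memLp_shiftDiff (memLp_shiftDiff hq h) h).1
    (memLp_shiftDiff (memLp_shiftDiff (hq.sub hg) h) h).1 one_le_two).trans ?_
  refine (add_le_add hqu hqd).trans ?_
  rw [← ENNReal.ofReal_add (by positivity) (by positivity)]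
  refine ENNReal.ofReal_le_ofReal ?_
  have : 0 ≤ 6 * Q * ‖h‖ ^ (r - 1) := by positivity
  linarith

/-- Second differences of order `r < 2` control the Besov norm. -/
theorem exists_besovNorm_le (N : ℕ) {r : ℝ} (hr0 : 0 < r) (hr2 : r < 2) :
    ∃ C : ℝ, 0 ≤ C ∧ ∀ (u : Eucl N → ℝ) (Q : ℝ), 0 ≤ Q → MemLp u 2 volume →
      Integrable u volume → eLpNorm u 2 volume ≤ ENNReal.ofReal Q →
      (∀ h : Eucl N, h ≠ 0 →
        eLpNorm (shiftDiff h (shiftDiff h u)) 2 volume ≤ ENNReal.ofReal (Q * ‖h‖ ^ r)) →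
      besovNorm r u ≤ ENNReal.ofReal (C * Q) := by
  rcases le_or_gt r 1 with hr1 | hr1
  · refine ⟨2, two_pos.le, fun u Q hQ hu _ huQ H => ?_⟩
    rw [besovNorm_of_le_one hr0 hr1, two_mul, ENNReal.ofReal_add hQ hQ]
    exact add_le_add huQ (secondDiffSeminorm_le H)
  set β : ℝ := (2 : ℝ) ^ (1 - r) with hβ
  have hβ0 : 0 < β := by positivity
  have hβ1 : β < 1 := Real.rpow_lt_one_of_one_lt_of_neg one_lt_two (by linarith)
  set K : ℝ := (1 - β)⁻¹ with hK
  have hK0 : 0 ≤ K := inv_nonneg.2 (by linarith)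
  -- For each derivative, 10 + 9K is 2 + K from its L² norm plus 8(1 + K) from its second
  -- differences.
  refine ⟨1 + N * (10 + 9 * K), by positivity, fun u Q hQ hu hu1 huQ H => ?_⟩
  rw [besovNorm_of_one_lt hr1, add_mul, one_mul, mul_assoc,
    ENNReal.ofReal_add hQ (by positivity)]
  refine add_le_add huQ ?_
  have hterm : ∀ i : Fin N, (⨅ (g : Eucl N → ℝ) (_ : IsWeakPartial i u g), besovNorm (r - 1) g)
      ≤ ENNReal.ofReal ((10 + 9 * K) * Q) := by
    intro i
    set e : Eucl N := EuclideanSpace.single i 1 with he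
    have hen : ‖e‖ = 1 := by simp [he]
    obtain ⟨g, hg, hqg⟩ := exists_limit_dyadicQuotient hr1 hQ hu H hen
    have hqg' : ∀ k : ℕ, eLpNorm (dyadicQuotient e u k - g) 2 volume
        ≤ ENNReal.ofReal (K * Q * β ^ k) := by
      intro k
      refine (hqg k).trans_eq ?_
      rw [hK, ← hβ]
      congr 1
      ring
    have hlim : Tendsto (fun k => eLpNorm (dyadicQuotient e u k - g) 2 volume) atTop (𝓝 0) := by
      have h1 : Tendsto (fun k : ℕ => ENNReal.ofReal (K * Q * β ^ k)) atTop (𝓝 0) := by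
        rw [← ENNReal.ofReal_zero, ← mul_zero (K * Q)]
        exact ENNReal.tendsto_ofReal
          ((tendsto_pow_atTop_nhds_zero_of_lt_one hβ0.le hβ1).const_mul _)
      exact tendsto_of_tendsto_of_tendsto_of_le_of_le tendsto_const_nhds h1
        (fun _ => zero_le) hqg'
    have hgK : eLpNorm g 2 volume ≤ ENNReal.ofReal ((2 + K) * Q) := by
      have hq := memLp_dyadicQuotient hu e 0
      have h1 : g = dyadicQuotient e u 0 - (dyadicQuotient e u 0 - g) := by rw [sub_sub_cancel]
      rw [h1]
      refine (eLpNorm_sub_le hq.1 (hq.sub hg).1 one_le_two).trans ?_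
      rw [add_mul, ENNReal.ofReal_add (by positivity) (by positivity)]
      refine add_le_add ?_ ((hqg' 0).trans_eq (by rw [pow_zero, mul_one]))
      rw [dyadicQuotient, pow_zero, one_smul, ENNReal.ofReal_mul two_pos.le]
      refine (eLpNorm_shiftDiff_le hu _).trans ?_
      simpa using mul_le_mul_right huQ 2
    refine iInf₂_le_of_le g (isWeakPartial_of_tendsto hu hu1 hg i hlim) ?_
    rw [besovNorm_of_le_one (by linarith) (by linarith)]
    refine (add_le_add hgK (secondDiffSeminorm_le
      (eLpNorm_second_difference_limit_le hr1 hr2 hQ hu hg H hK0 hgK hqg'))).trans_eq ?_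
    rw [← ENNReal.ofReal_add (by positivity) (by positivity)]
    congr 1
    ring
  refine (Finset.sum_le_sum fun i _ => hterm i).trans_eq ?_
  rw [Finset.sum_const, Finset.card_univ, Fintype.card_fin, nsmul_eq_mul,
    ENNReal.ofReal_mul (Nat.cast_nonneg N), ENNReal.ofReal_natCast]

end Besov

/-! ### Independence of the a.e. representative -/

section Congruence

variable {N : ℕ} {s : ℝ} {u v : Eucl N → ℝ}

theorem ae_prod_eq (h : u =ᵐ[volume] v) :
    ∀ᵐ p : Eucl N × Eucl N, u p.1 = v p.1 ∧ u p.2 = v p.2 := by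
  rw [Measure.volume_eq_prod]
  exact (Measure.quasiMeasurePreserving_fst.ae h).and (Measure.quasiMeasurePreserving_snd.ae h)

theorem gagliardoSq_congr (h : u =ᵐ[volume] v) : gagliardoSq s u = gagliardoSq s v := by
  refine lintegral_congr_ae ?_
  filter_upwards [ae_prod_eq h] with p hp
  rw [hp.1, hp.2]

theorem IsWeakSolution.congr [NeZero N] {Ω : Set (Eucl N)} {f : Eucl N → ℝ}
    (hu : IsWeakSolution s Ω f u) (h : u =ᵐ[volume] v) : IsWeakSolution s Ω f v := by
  refine ⟨⟨⟨hu.1.1.1.ae_eq h, (gagliardoSq_congr h).symm.trans_lt hu.1.1.2⟩, ?_⟩, fun φ hφ => ?_⟩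
  · filter_upwards [hu.1.2, h] with x hx hxe hxΩ
    rw [← hxe, hx hxΩ]
  · rw [← hu.2 φ hφ]
    congr 1
    refine integral_congr_ae ?_
    filter_upwards [ae_prod_eq h] with p hp
    rw [hp.1, hp.2]

theorem IsWeakPartial.congr_left {i : Fin N} {g : Eucl N → ℝ} (hu : IsWeakPartial i u g)
    (h : u =ᵐ[volume] v) : IsWeakPartial i v g := by
  refine ⟨hu.1.congr h, hu.2.1, fun φ hφ hφc => ?_⟩
  rw [← hu.2.2 φ hφ hφc]
  refine integral_congr_ae ?_
  filter_upwards [h] with x hx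
  rw [hx]

theorem secondDiffSeminorm_congr {r : ℝ} (h : u =ᵐ[volume] v) :
    secondDiffSeminorm r u = secondDiffSeminorm r v := by
  refine iSup_congr fun k => iSup_congr fun _ => ?_
  congr 1
  refine eLpNorm_congr_ae ?_
  filter_upwards [h, (measurePreserving_add_right volume k).quasiMeasurePreserving.ae h,
    (measurePreserving_add_right volume ((2 : ℝ) • k)).quasiMeasurePreserving.ae h]
    with x h0 h1 h2
  rw [h0, h1, h2]

theorem besovNorm_congr {r : ℝ} (h : u =ᵐ[volume] v) : besovNorm r u = besovNorm r v := by
  unfold besovNorm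
  cases ⌈r⌉₊ - 1 with
  | zero => simp only [besovNormAux, eLpNorm_congr_ae h, secondDiffSeminorm_congr h]
  | succ k =>
    simp only [besovNormAux, eLpNorm_congr_ae h]
    congr 1
    refine Finset.sum_congr rfl fun i _ => iInf_congr fun g => ?_
    exact iInf_congr_Prop ⟨fun hu => hu.congr_left h, fun hv => hv.congr_left h.symm⟩ fun _ => rfl

end Congruence

/-! ### Poincaré inequality, duality and the final estimate -/

section MainEstimate

variable {N : ℕ} {s : ℝ}

theorem gagliardoSq_const_mul {u : Eucl N → ℝ} (hu : Measurable u) (c : ℝ) :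
    gagliardoSq s (fun x => c * u x) = ENNReal.ofReal (c ^ 2) * gagliardoSq s u := by
  rw [gagliardoSq_eq_lintegral hu, gagliardoSq_eq_lintegral (hu.const_mul c),
    ← lintegral_const_mul _ (by fun_prop)]
  refine lintegral_congr fun p => ?_
  rw [← ENNReal.ofReal_mul (sq_nonneg c)]
  congr 1
  ring

theorem dualSobolevNorm_le_eLpNorm {f : Eucl N → ℝ} (hf : MemLp f 2 volume) :
    dualSobolevNorm s f ≤ eLpNorm f 2 volume := by
  refine iSup_le fun φ => iSup₂_le fun hφ hφ1 => ?_
  refine (enorm_integral_mul_le hf hφ.1).trans ?_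
  refine mul_le_of_le_one_right' (le_trans ?_ hφ1)
  calc eLpNorm φ 2 volume = (eLpNorm φ 2 volume ^ 2) ^ (1 / 2 : ℝ) := by
        rw [← ENNReal.rpow_natCast, ← ENNReal.rpow_mul]
        norm_num
    _ ≤ _ := ENNReal.rpow_le_rpow le_self_add (by norm_num)

/-- The fractional Poincaré inequality. -/
theorem integral_sq_le_of_support [NeZero N] (hs : 0 < s) {Ω : Set (Eucl N)} {x₁ : Eucl N} {d : ℝ}
    (hΩ : Ω ⊆ Metric.closedBall x₁ d) {u : Eucl N → ℝ} (hm : Measurable u)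
    (hu : MemSobolev s u) (hu0 : ∀ x, x ∉ Ω → u x = 0) :
    ∫ x, u x ^ 2 ≤ shiftConst N s * (2 * |d| + 1) ^ (2 * s) * (gagliardoSq s u).toReal := by
  -- A shift longer than the diameter of the ball moves Ω off itself, so on Ω the difference is -u
  -- and the first-difference estimate bounds u.
  set h : Eucl N := EuclideanSpace.single 0 (2 * |d| + 1) with hh
  have hn : ‖h‖ = 2 * |d| + 1 := by
    rw [hh, PiLp.norm_single, Real.norm_of_nonneg (by positivity)]
  have h1 := integral_shiftDiff_sq_le hs hm hu.2 h
  rw [hn] at h1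
  refine le_trans (integral_mono hu.1.integrable_sq (memLp_shiftDiff hu.1 h).integrable_sq
    fun x => ?_) h1
  simp only
  by_cases hx : x ∈ Ω
  · have hxh : x + h ∉ Ω := by
      intro hxh
      have e1 := hΩ hx
      have e2 := hΩ hxh
      rw [Metric.mem_closedBall, dist_eq_norm] at e1 e2
      have e3 := norm_sub_le (x + h - x₁) (x - x₁)
      rw [sub_sub_sub_cancel_right, add_sub_cancel_left, hn] at e3
      linarith [le_abs_self d]
    rw [shiftDiff, hu0 _ hxh, zero_sub, neg_sq]
  · rw [hu0 x hx, zero_pow two_ne_zero]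
    exact sq_nonneg _

/-- With P the Poincaré constant, √((P+1)E) bounds the H^s norm of u; dividing u by it gives a
competitor in the dual norm. -/
theorem abs_integral_mul_le_dual {f u : Eucl N → ℝ} (hf : MemLp f 2 volume)
    (hm : Measurable u) (hu : MemSobolev s u) {P : ℝ} (hP : 0 ≤ P)
    (hPu : ∫ x, u x ^ 2 ≤ P * (gagliardoSq s u).toReal) (hE : 0 < (gagliardoSq s u).toReal) :
    |∫ x, f x * u x|
      ≤ (dualSobolevNorm s f).toReal * (√(P + 1) * √(gagliardoSq s u).toReal) := by
  set E := (gagliardoSq s u).toReal with hEdef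
  set σ := √(P + 1) * √E with hσ
  have hσ0 : 0 < σ := by positivity
  have hσ2 : σ ^ 2 = (P + 1) * E := by
    rw [hσ, mul_pow, Real.sq_sqrt (by positivity), Real.sq_sqrt hE.le]
  have hEe : gagliardoSq s u = ENNReal.ofReal E := (ENNReal.ofReal_toReal hu.2.ne).symm
  set φ : Eucl N → ℝ := fun x => σ⁻¹ * u x with hφ
  have hφg : gagliardoSq s φ = ENNReal.ofReal (σ⁻¹ ^ 2 * E) := by
    rw [hφ, gagliardoSq_const_mul hm, hEe, ← ENNReal.ofReal_mul (sq_nonneg _)]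
  have hφS : MemSobolev s φ := ⟨hu.1.const_mul _, by rw [hφg]; exact ENNReal.ofReal_lt_top⟩
  have hφL : eLpNorm φ 2 volume ^ 2 ≤ ENNReal.ofReal (σ⁻¹ ^ 2 * (P * E)) := by
    rw [eLpNorm_two_sq_eq]
    refine (ENNReal.le_ofReal_iff_toReal_le ((lintegral_ofReal_sq_lt_top_iff
      (hm.const_mul _)).2 hφS.1).ne (by positivity)).2 ?_
    rw [← integral_sq_eq_toReal (hm.const_mul _)]
    simp only [mul_pow]
    rw [integral_const_mul]
    gcongr
  have hφ1 : sobolevNorm s φ ≤ 1 := by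
    refine ENNReal.rpow_le_one ?_ (by norm_num)
    rw [hφg]
    refine (add_le_add hφL le_rfl).trans ?_
    rw [← ENNReal.ofReal_add (by positivity) (by positivity), ENNReal.ofReal_le_one, ← mul_add,
      show P * E + E = σ ^ 2 by rw [hσ2]; ring, ← mul_pow, inv_mul_cancel₀ hσ0.ne', one_pow]
  have hdual : ‖∫ x, f x * φ x‖ₑ ≤ dualSobolevNorm s f :=
    le_iSup_of_le φ (le_iSup₂_of_le hφS hφ1 le_rfl)
  have h1 := ENNReal.toReal_mono ((dualSobolevNorm_le_eLpNorm hf).trans_lt hf.2).ne hdual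
  rw [toReal_enorm, Real.norm_eq_abs] at h1
  have h2 : ∫ x, f x * φ x = σ⁻¹ * ∫ x, f x * u x := by
    rw [← integral_const_mul]
    refine integral_congr_ae (Eventually.of_forall fun x => ?_)
    simp only [hφ]
    ring
  rw [h2, abs_mul, abs_of_pos (inv_pos.2 hσ0), inv_mul_le_iff₀ hσ0] at h1
  rwa [mul_comm] at h1

theorem integrable_of_support_subset {Ω : Set (Eucl N)} {x₁ : Eucl N} {d : ℝ}
    (hΩ : Ω ⊆ Metric.closedBall x₁ d) {u : Eucl N → ℝ} (hu : MemLp u 2 volume)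
    (hu0 : ∀ x, x ∉ Ω → u x = 0) : Integrable u volume := by
  have hsupp : Function.support u ⊆ Metric.closedBall x₁ d := fun x hx =>
    hΩ (by_contra fun hxΩ => hx (hu0 x hxΩ))
  rw [← integrableOn_iff_integrable_of_support_subset hsupp]
  have : IsFiniteMeasure ((volume : Measure (Eucl N)).restrict (Metric.closedBall x₁ d)) :=
    ⟨by simpa using measure_closedBall_lt_top⟩
  exact (hu.restrict _).integrable one_le_two

theorem eLpNorm_le_ofReal_of_sq_le {v : Eucl N → ℝ} {y : ℝ}
    (h : ∫⁻ x, ENNReal.ofReal (v x ^ 2) ≤ ENNReal.ofReal (y ^ 2)) (hy : 0 ≤ y) :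
    eLpNorm v 2 volume ≤ ENNReal.ofReal y := by
  rw [← eLpNorm_two_sq_eq, ENNReal.ofReal_pow hy] at h
  exact (ENNReal.pow_le_pow_left_iff two_ne_zero).1 h

theorem exists_besovNorm_solution_le (N : ℕ) [NeZero N] {s ρ θ : ℝ} (d : ℝ) (hs0 : 0 < s)
    (hs1 : s < 1) (hρ : 0 < ρ) (hθ0 : 0 < θ) (hθ1 : θ < Real.pi / 2) :
    ∃ C : ℝ, 0 ≤ C ∧ ∀ (Ω : Set (Eucl N)) (f u : Eucl N → ℝ) (x₁ : Eucl N),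
      LipschitzCone ρ θ Ω → Ω ⊆ Metric.closedBall x₁ d →
      MemLp f 2 volume → Measurable u → (∀ x, x ∉ Ω → u x = 0) → IsWeakSolution s Ω f u →
      besovNorm (3 * s / 2) u ≤ ENNReal.ofReal
        (C * √((dualSobolevNorm s f).toReal * (eLpNorm f 2 volume).toReal)) := by
  obtain ⟨C₁, h₀, hC₁, hh₀, hshift⟩ := exists_gagliardoSq_shiftDiff_le N d hs0 hs1 hρ hθ0 hθ1
  obtain ⟨C₂, hC₂, hbesov⟩ := exists_besovNorm_le N (r := 3 * s / 2) (by linarith) (by linarith)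
  set c := normConst N s with hc
  have hc0 : 0 < c := normConst_pos hs0 hs1
  set S := shiftConst N s with hS
  have hS0 : 0 < S := shiftConst_pos
  set P := S * (2 * |d| + 1) ^ (2 * s) with hP
  have hP0 : 0 ≤ P := by positivity
  set A := c⁻¹ * √(P + 1) with hA
  have hA0 : 0 ≤ A := by positivity
  set B₁ := √(S * C₁ * (A ^ 2 + A)) with hB₁
  -- The three summands serve, in order, steps up to h₀, larger steps, and the L² norm of u.
  set B := B₁ + 4 * (√P * A) * (h₀ ^ (3 * s / 2))⁻¹ + √P * A with hB
  have hB₁0 : 0 ≤ B₁ := Real.sqrt_nonneg _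
  refine ⟨C₂ * B, by positivity, ?_⟩
  intro Ω f u x₁ hΩ hΩd hf hm hu0 hu
  have hu1 := hu.1.1
  set E := (gagliardoSq s u).toReal with hE
  set G := (dualSobolevNorm s f).toReal with hG
  set F := (eLpNorm f 2 volume).toReal with hF
  have hE0 : 0 ≤ E := ENNReal.toReal_nonneg
  have hG0 : 0 ≤ G := ENNReal.toReal_nonneg
  have hF0 : 0 ≤ F := ENNReal.toReal_nonneg
  have hGF : G ≤ F := ENNReal.toReal_mono hf.2.ne (dualSobolevNorm_le_eLpNorm hf)
  set Q := √(G * F) with hQ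
  have hQ0 : 0 ≤ Q := Real.sqrt_nonneg _
  have hQ2 : Q ^ 2 = G * F := Real.sq_sqrt (by positivity)
  have hGQ : G ≤ Q := Real.le_sqrt_of_sq_le (by nlinarith)
  have hpoinc : ∫ x, u x ^ 2 ≤ P * E := integral_sq_le_of_support hs0 hΩd hm hu1 hu0
  have hEA : √E ≤ A * G := by
    rcases hE0.eq_or_lt with h0 | hEpos
    · rw [← h0, Real.sqrt_zero]
      positivity
    have h1 := abs_integral_mul_le_dual hf hm hu1 hP0 hpoinc hEpos
    rw [← hE, ← hG] at h1
    -- Testing with u itself gives c E = ∫ f u; one factor √E then cancels against the dual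
    -- estimate.
    have h2 := hu.2 u hu.1
    have h3 : ∫ p : Eucl N × Eucl N, kernel s (p.1 - p.2) * ((u p.1 - u p.2) * (u p.1 - u p.2))
        = E := by
      rw [hE, ← integral_incr_sq hm, integral_gagliardoMeasure]
      refine integral_congr_ae (Eventually.of_forall fun p => ?_)
      simp only [incr]
      ring
    rw [h3, ← hc] at h2
    rw [← h2, abs_of_nonneg (by positivity)] at h1
    have hsE : 0 < √E := Real.sqrt_pos.2 hEpos
    have h4 : c * √E ≤ G * √(P + 1) := by
      refine le_of_mul_le_mul_right ?_ hsE
      calc c * √E * √E = c * E := by rw [mul_assoc, Real.mul_self_sqrt hE0]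
        _ ≤ G * (√(P + 1) * √E) := h1
        _ = _ := by ring
    rw [hA, mul_assoc, mul_comm (√(P + 1)), le_inv_mul_iff₀ hc0]
    exact h4
  have hM : dataEnergy s f u ≤ (A ^ 2 + A) * Q ^ 2 := by
    rw [dataEnergy, ← hE, ← hF, hQ2]
    have h1 : E ≤ (A * G) ^ 2 := by
      rw [← Real.sq_sqrt hE0]
      exact pow_le_pow_left₀ (Real.sqrt_nonneg _) hEA 2
    have h2 : F * √E ≤ F * (A * G) := by gcongr
    have h3 : A ^ 2 * (G * G) ≤ A ^ 2 * (G * F) := by gcongr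
    nlinarith
  have huL : eLpNorm u 2 volume ≤ ENNReal.ofReal (√P * A * Q) := by
    refine eLpNorm_le_ofReal_of_sq_le ?_ (by positivity)
    refine (ENNReal.le_ofReal_iff_toReal_le ((lintegral_ofReal_sq_lt_top_iff hm).2 hu1.1).ne
      (by positivity)).2 ?_
    rw [← integral_sq_eq_toReal hm]
    refine hpoinc.trans ?_
    have h1 : √E ≤ A * Q := hEA.trans (by gcongr)
    calc P * E = (√P * √E) ^ 2 := by rw [mul_pow, Real.sq_sqrt hP0, Real.sq_sqrt hE0]
      _ ≤ (√P * (A * Q)) ^ 2 := by gcongr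
      _ = _ := by ring
  have hsecond : ∀ h : Eucl N, h ≠ 0 → eLpNorm (shiftDiff h (shiftDiff h u)) 2 volume
      ≤ ENNReal.ofReal (B * Q * ‖h‖ ^ (3 * s / 2)) := by
    intro h hh
    have hhp : 0 < ‖h‖ := norm_pos_iff.2 hh
    have ht : 0 < ‖h‖ ^ (3 * s / 2) := by positivity
    rcases le_or_gt ‖h‖ h₀ with hle | hgt
    · have h1 : eLpNorm (shiftDiff h (shiftDiff h u)) 2 volume
          ≤ ENNReal.ofReal (B₁ * Q * ‖h‖ ^ (3 * s / 2)) := by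
        refine eLpNorm_le_ofReal_of_sq_le ?_ (by positivity)
        -- The outer difference contributes |h|^(2s) and the energy of the inner one |h|^s: the
        -- exponent 3s/2 after the square root.
        refine (lintegral_shiftDiff_sq_le hs0 (measurable_shiftDiff hm h) h).trans ?_
        refine (mul_le_mul_right (hshift Ω f u x₁ hΩ hΩd hf hm hu0 hu h hle) _).trans ?_
        rw [← ENNReal.ofReal_mul (by positivity)]
        refine ENNReal.ofReal_le_ofReal ?_
        have e1 : (‖h‖ ^ (3 * s / 2)) ^ 2 = ‖h‖ ^ (2 * s) * ‖h‖ ^ s := by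
          rw [← Real.rpow_natCast, ← Real.rpow_mul hhp.le, ← Real.rpow_add hhp]
          congr 1
          push_cast
          ring
        rw [mul_pow, mul_pow, hB₁, Real.sq_sqrt (by positivity), e1]
        calc S * ‖h‖ ^ (2 * s) * (C₁ * ‖h‖ ^ s * dataEnergy s f u)
            ≤ S * ‖h‖ ^ (2 * s) * (C₁ * ‖h‖ ^ s * ((A ^ 2 + A) * Q ^ 2)) := by gcongr
          _ = _ := by ring
      refine h1.trans (ENNReal.ofReal_le_ofReal ?_)
      gcongr
      rw [hB, add_assoc]
      exact le_add_of_nonneg_right (by positivity)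
    · refine (eLpNorm_shiftDiff_shiftDiff_le hu1.1 h).trans ?_
      refine (mul_le_mul_right huL 4).trans ?_
      have h4 : ∀ X : ℝ, 4 * ENNReal.ofReal X = ENNReal.ofReal (4 * X) := by
        intro X
        rw [ENNReal.ofReal_mul four_pos.le]
        simp
      rw [h4]
      refine ENNReal.ofReal_le_ofReal ?_
      have hh₀p : 0 < h₀ ^ (3 * s / 2) := by positivity
      have h5 : 1 ≤ (h₀ ^ (3 * s / 2))⁻¹ * ‖h‖ ^ (3 * s / 2) := by
        rw [le_inv_mul_iff₀ hh₀p, mul_one]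
        exact Real.rpow_le_rpow hh₀.le hgt.le (by positivity)
      calc 4 * (√P * A * Q) ≤ 4 * (√P * A * Q) * ((h₀ ^ (3 * s / 2))⁻¹ * ‖h‖ ^ (3 * s / 2)) :=
            le_mul_of_one_le_right (by positivity) h5
        _ = 4 * (√P * A) * (h₀ ^ (3 * s / 2))⁻¹ * Q * ‖h‖ ^ (3 * s / 2) := by ring
        _ ≤ B * Q * ‖h‖ ^ (3 * s / 2) := by
            gcongr
            rw [hB]
            have : 0 ≤ √P * A := by positivity
            linarith
  have hfin := hbesov u (B * Q) (by positivity) hu1.1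
    (integrable_of_support_subset hΩd hu1.1 hu0)
    (huL.trans (ENNReal.ofReal_le_ofReal (by
      gcongr
      rw [hB]
      exact le_add_of_nonneg_left (by positivity)))) hsecond
  rwa [← mul_assoc] at hfin

end MainEstimate

end FracPoisson

theorem mainTheorem2 (N : ℕ) [NeZero N] (s ρ θ d : ℝ) (hs0 : 0 < s) (hs1 : s < 1)
    (hρ : 0 < ρ) (hθ0 : 0 < θ) (hθ1 : θ < Real.pi / 2) :
    ∃ C : NNReal, ∀ Ω : Set (EuclideanSpace ℝ (Fin N)),
      IsOpen Ω → Bornology.IsBounded Ω → Metric.diam Ω = d →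
      FracPoisson.LipschitzCone ρ θ Ω →
      ∀ f u : EuclideanSpace ℝ (Fin N) → ℝ, MeasureTheory.MemLp f 2 MeasureTheory.volume →
        FracPoisson.IsWeakSolution s Ω f u →
        FracPoisson.MemBesov (3 * s / 2) u ∧
        FracPoisson.besovNorm (3 * s / 2) u ≤
          C * FracPoisson.dualSobolevNorm s f ^ (1 / 2 : ℝ)
            * MeasureTheory.eLpNorm f 2 MeasureTheory.volume ^ (1 / 2 : ℝ) := by
  obtain ⟨C, hC, hmain⟩ :=
    FracPoisson.exists_besovNorm_solution_le N d hs0 hs1 hρ hθ0 hθ1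
  refine ⟨C.toNNReal, fun Ω hΩo hΩb hΩd hΩ f u hf hu => ?_⟩
  -- Any point of Ω serves as centre with radius d, so Ω enters the constant only through its
  -- diameter.
  obtain ⟨x₁, hx₁⟩ : ∃ x₁, Ω ⊆ Metric.closedBall x₁ d := by
    rcases Ω.eq_empty_or_nonempty with rfl | ⟨x₁, hx₁⟩
    · exact ⟨0, Set.empty_subset _⟩
    · exact ⟨x₁, fun x hx => hΩd ▸ Metric.dist_le_diam_of_mem hΩb hx hx₁⟩
  set g := hu.1.1.1.1.mk u with hg
  have hgm : Measurable g := hu.1.1.1.1.stronglyMeasurable_mk.measurable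
  -- The estimates need a representative that is Borel measurable and vanishes everywhere off Ω, not
  -- just almost everywhere.
  have hug : u =ᵐ[volume] Ω.indicator g := by
    filter_upwards [hu.1.1.1.1.ae_eq_mk, hu.1.2] with x h1 h2
    by_cases hx : x ∈ Ω
    · rw [Set.indicator_of_mem hx, h1]
    · rw [Set.indicator_of_notMem hx, h2 hx]
  have hle : FracPoisson.besovNorm (3 * s / 2) u ≤
      C.toNNReal * FracPoisson.dualSobolevNorm s f ^ (1 / 2 : ℝ)
        * eLpNorm f 2 volume ^ (1 / 2 : ℝ) := by
    rw [FracPoisson.besovNorm_congr hug]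
    refine (hmain Ω f (Ω.indicator g) x₁ hΩ hx₁ hf (hgm.indicator hΩo.measurableSet)
      (fun x hx => Set.indicator_of_notMem hx g) (hu.congr hug)).trans_eq ?_
    have hdual := ((FracPoisson.dualSobolevNorm_le_eLpNorm (s := s) hf).trans_lt hf.2).ne
    rw [ENNReal.ofReal_mul hC, mul_assoc, ← ENNReal.mul_rpow_of_nonneg _ _ (by norm_num),
      Real.sqrt_eq_rpow, ← ENNReal.ofReal_rpow_of_nonneg (by positivity) (by norm_num),
      ENNReal.ofReal_mul ENNReal.toReal_nonneg, ENNReal.ofReal_toReal hdual,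
      ENNReal.ofReal_toReal hf.2.ne]
    rfl
  refine ⟨⟨hu.1.1.1, hle.trans_lt ?_⟩, hle⟩
  have hdual := (FracPoisson.dualSobolevNorm_le_eLpNorm (s := s) hf).trans_lt hf.2
  exact ENNReal.mul_lt_top (ENNReal.mul_lt_top ENNReal.coe_lt_top
    (ENNReal.rpow_lt_top_of_nonneg (by norm_num) hdual.ne))
    (ENNReal.rpow_lt_top_of_nonneg (by norm_num) hf.2.ne)
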